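/- Let $\mathbb{K}$ be an arbitrary field, let $k \ge 2$ be an integer, and let $T \in \mathbb{K}^{n_1} \otimes \cdots \otimes \mathbb{K}^{n_k}$ be a nonzero tensor of order $k$. The subrank $\mathrm{Q}(S)$ of a tensor $S \in V_1 \otimes \cdots \otimes V_k$ (with finite-dimensional $\mathbb{K}$-vector spaces $V_i$) is the largest integer $r \ge 0$ for which there are linear maps $\pi_i : V_i \to \mathbb{K}^r$ with $(\pi_1 \otimes \cdots \otimes \pi_k) S = \sum_{j=1}^r e_j \otimes \cdots \otimes e_j$. The Kronecker power $T^{\boxtimes N} \in \mathbb{K}^{n_1^N} \otimes \cdots \otimes \mathbb{K}^{n_k^N}$ is the tensor of order $k$ whose coefficients are the products of $N$ coefficients of $T$: with the standard basis of $\mathbb{K}^{n_i^N}$ indexed by $[n_i]^N$, its coefficient at $(x_1,\ldots,x_k) \in [n_1]^N \times \cdots \times [n_k]^N$ is $\prod_{l=1}^N T_{x_1(l),\ldots,x_k(l)}$. Then the limit defining the asymptotic subrank $$\widetilde{\mathrm{Q}}(T) := \lim_{N \to \infty} \mathrm{Q}(T^{\boxtimes N})^{1/N}$$ exists, and one of the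 following is true: (a) $\widetilde{\mathrm{Q}}(T) = 1$; (b) $\widetilde{\mathrm{Q}}(T) \ge c_k$, where $c_k = \dfrac{k}{(k-1)^{(k-1)/k}}$. -/

import Mathlib

open scoped TensorProduct Topology

noncomputable section

namespace KTensor

variable {K : Type*} [Field K] {k : ℕ}

/-- `T` restricts to `S` when `S = (π₁ ⊗ ⋯ ⊗ πₖ) T` for some linear maps `πᵢ : Vᵢ → Wᵢ`. -/
def Restricts {V W : Fin k → Type*}
    [∀ i, AddCommGroup (V i)] [∀ i, Module K (V i)]
    [∀ i, AddCommGroup (W i)] [∀ i, Module K (W i)]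
    (T : ⨂[K] i, V i) (S : ⨂[K] i, W i) : Prop :=
  ∃ π : ∀ i, V i →ₗ[K] W i, PiTensorProduct.map π T = S

/-- The unit tensor `∑ⱼ eⱼ ⊗ ⋯ ⊗ eⱼ` of order `k` and rank `r`, in `Kʳ ⊗ ⋯ ⊗ Kʳ`. -/
def unitTensor (K : Type*) [Field K] (k r : ℕ) : ⨂[K] _i : Fin k, (Fin r → K) :=
  ∑ j : Fin r, PiTensorProduct.tprod K fun _ : Fin k => (Pi.single j 1 : Fin r → K)

/-- The subrank: the largest `r` such that `T` restricts to the unit tensor of rank `r`.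
For `k ≥ 2` and finite-dimensional factors, the set of such `r` contains `0` and is bounded above
by the dimension of every factor, so that the supremum is a maximum. -/
def subrank {V : Fin k → Type*} [∀ i, AddCommGroup (V i)] [∀ i, Module K (V i)]
    (T : ⨂[K] i, V i) : ℕ :=
  sSup {r : ℕ | Restricts T (unitTensor K k r)}

/-- The identification of tensors in `⨂ᵢ K^(ιᵢ)` with `k`-dimensional arrays of scalars: the
array of `T` consists of the coordinates of `T` in the standard basis `⨂ᵢ e_(xᵢ)`. -/
def toArray {ι : Fin k → Type*} [∀ i, Fintype (ι i)] :
    (⨂[K] i, (ι i → K)) ≃ₗ[K] ((∀ i, ι i) → K) :=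
  (Basis.piTensorProduct fun i => Pi.basisFun K (ι i)).equivFun

/-- The `N`-th Kronecker power of a tensor. The `i`-th factor `K^(ιᵢ ^ N)` has its standard basis
indexed by `N`-tuples of elements of `ιᵢ`, and the coefficients of the power are the `N`-fold
products of coefficients of `T`. -/
def kroneckerPow {ι : Fin k → Type*} [∀ i, Fintype (ι i)] (T : ⨂[K] i, (ι i → K)) (N : ℕ) :
    ⨂[K] i, ((Fin N → ι i) → K) :=
  toArray.symm fun x => ∏ l : Fin N, toArray T fun i => x i l

/-- The asymptotic subrank `lim_{N → ∞} Q(T^{⊠N})^{1/N}`. -/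
def asymptoticSubrank {ι : Fin k → Type*} [∀ i, Fintype (ι i)] (T : ⨂[K] i, (ι i → K)) : ℝ :=
  Filter.limUnder Filter.atTop fun N : ℕ => (subrank (kroneckerPow T N) : ℝ) ^ (1 / (N : ℝ))

end KTensor

end

/-! View `T` as a multilinear form `f`. The dichotomy is whether `f` splits as a product along some
bipartition of its directions. `Exch` expresses splitting through values only, as the vanishing of 2
× 2 minors of a flattening at product vectors. A splitting is inherited by all Kronecker powers and
forbids two diagonal entries, so every subrank is then 1.

If nothing splits, `exch_of_forall_singleton` shows that every bipartition is crossed by a pair of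
directions with a nonvanishing minor. Over an infinite field the relation of having such a minor is
transitive, hence holds for all pairs, and a generic choice yields vectors `a`, `b` with `f a = 0`
but `f` nonzero whenever one single `a i` is replaced by `b i` (`exists_zero_of_not_exch`). This is
the leading part of a W-tensor. In the power with exponent `k * M`, a partition `P` of the positions
into `k` blocks of size `M` gives vectors that use `b i` on block `i` and `a i` elsewhere. A
contraction mixing several partitions vanishes at any uncovered position, so by counting it survives
only if the chosen blocks again form a partition. A family whose blocks never mix therefore yields a
unit tensor.

Strassen's hashing with Behrend's average-free sets (`exists_large_isUnmixable`) finds such families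
of size `k ^ (k * M) / (k - 1) ^ ((k - 1) * M)`, up to factors of arbitrarily small exponential
rate. The root of order `k * M` of this size is `c_k`.

The vectors live over a finite extension of `K`. Expansion in a basis writes a diagonalisation over
it as a sum of boundedly many contractions over `K`. A unit tensor of constant size, found in a
fixed power of `T` (`exists_diag_two`), realises this sum, at the cost of a constant shift of the
exponent. -/

namespace KTensor

/-! ### Contractions, diagonalisations and the subrank -/

section Contraction

variable {K : Type*} [Field K] {k : ℕ} {ι κ : Fin k → Type*} [∀ i, Fintype (ι i)]
  [∀ i, Fintype (κ i)]

/-- The full contraction of an array of scalars against one vector, with entries in a commutative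
algebra, for every coordinate direction. -/
noncomputable def contract (R : Type*) [CommRing R] [Algebra K R] (T : (∀ i, ι i) → K) :
    MultilinearMap R (fun i => ι i → R) R :=
  ∑ x, algebraMap K R (T x) •
    (MultilinearMap.mkPiAlgebra R (Fin k) R).compLinearMap fun i => LinearMap.proj (x i)

theorem contract_apply {R : Type*} [CommRing R] [Algebra K R] (T : (∀ i, ι i) → K)
    (a : ∀ i, ι i → R) : contract R T a = ∑ x, algebraMap K R (T x) * ∏ i, a i (x i) := by
  simp [contract]

theorem contract_apply_self (T : (∀ i, ι i) → K) (a : ∀ i, ι i → K) :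
    contract K T a = ∑ x, T x * ∏ i, a i (x i) :=
  contract_apply T a

theorem map_contract {R S : Type*} [CommRing R] [Algebra K R] [CommRing S] [Algebra K S]
    (f : R →ₐ[K] S) (T : (∀ i, ι i) → K) (a : ∀ i, ι i → R) :
    f (contract R T a) = contract S T fun i x => f (a i x) := by
  simp [contract_apply]

theorem contract_single (T : (∀ i, ι i) → K) [∀ i, DecidableEq (ι i)] (y : ∀ i, ι i) :
    contract K T (fun i => Pi.single (y i) 1) = T y := by
  rw [contract_apply_self, Finset.sum_eq_single y]
  · simp
  · intro x _ hxy
    obtain ⟨i, hi⟩ := Function.ne_iff.1 hxy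
    rw [Finset.prod_eq_zero (Finset.mem_univ i), mul_zero]
    simp [hi]
  · simp

/-- The array of the Kronecker product of two tensors. -/
def boxProd (T : (∀ i, ι i) → K) (S : (∀ i, κ i) → K) : (∀ i, ι i × κ i) → K :=
  fun z => T (fun i => (z i).1) * S fun i => (z i).2

/-- The array of the Kronecker power of a tensor. -/
def boxPow (T : (∀ i, ι i) → K) (N : ℕ) : (∀ i, Fin N → ι i) → K :=
  fun x => ∏ l, T fun i => x i l

/-- The equivalence between families of pairs and pairs of families. -/
def piProdEquiv (ι κ : Fin k → Type*) : (∀ i, ι i × κ i) ≃ (∀ i, ι i) × (∀ i, κ i) where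
  toFun z := (fun i => (z i).1, fun i => (z i).2)
  invFun p := fun i => (p.1 i, p.2 i)
  left_inv _ := rfl
  right_inv _ := rfl

theorem contract_boxProd {R : Type*} [CommRing R] [Algebra K R] (T : (∀ i, ι i) → K)
    (S : (∀ i, κ i) → K) (a : ∀ i, ι i → R) (b : ∀ i, κ i → R) :
    contract R (boxProd T S) (fun i z => a i z.1 * b i z.2) = contract R T a * contract R S b := by
  simp only [contract_apply]
  rw [Finset.sum_mul_sum, ← Fintype.sum_prod_type', ← (piProdEquiv ι κ).sum_comp]
  refine Finset.sum_congr rfl fun z _ => ?_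
  simp only [boxProd, piProdEquiv, Equiv.coe_fn_mk, map_mul, Finset.prod_mul_distrib]
  ring

/-- Distributivity: vectors of product form decouple the positions of the power. All
diagonalisations of powers below are evaluated in this way. -/
theorem contract_boxPow {R : Type*} [CommRing R] [Algebra K R] (T : (∀ i, ι i) → K) {N : ℕ}
    (a : Fin N → ∀ i, ι i → R) :
    contract R (boxPow T N) (fun i x => ∏ l, a l i (x l)) = ∏ l, contract R T (a l) := by
  classical
  simp only [contract_apply]
  rw [Fintype.prod_sum, ← (Equiv.piComm fun (_ : Fin N) (i : Fin k) => ι i).sum_comp]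
  refine Finset.sum_congr rfl fun x _ => ?_
  simp only [boxPow, map_prod, Finset.prod_mul_distrib, Equiv.piComm_apply, Function.swap]
  rw [Finset.prod_comm (s := (Finset.univ : Finset (Fin k)))]

open Classical in
/-- The coefficients of the unit tensor: `1` at constant families of indices, `0` elsewhere. -/
noncomputable def delta (K : Type*) [Field K] {k : ℕ} {J : Type*} (j : Fin k → J) : K :=
  if ∀ i i', j i = j i' then 1 else 0

theorem delta_of_forall {J : Type*} {j : Fin k → J} (h : ∀ i i', j i = j i') : delta K j = 1 :=
  if_pos h

theorem delta_of_not {J : Type*} {j : Fin k → J} (h : ¬∀ i i', j i = j i') : delta K j = 0 :=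
  if_neg h

theorem delta_congr {J J' : Type*} {j : Fin k → J} {j' : Fin k → J'}
    (h : (∀ i i', j i = j i') ↔ ∀ i i', j' i = j' i') : delta K j = delta K j' := by
  by_cases h' : ∀ i i', j' i = j' i'
  · rw [delta_of_forall h', delta_of_forall (h.2 h')]
  · rw [delta_of_not h', delta_of_not (mt h.1 h')]

theorem delta_prod {J J' : Type*} (j : Fin k → J × J') :
    delta K j = (delta K fun i => (j i).1) * delta K fun i => (j i).2 := by
  by_cases h : ∀ i i', j i = j i'
  · rw [delta_of_forall h, delta_of_forall fun i i' => congrArg Prod.fst (h i i'),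
      delta_of_forall fun i i' => congrArg Prod.snd (h i i'), one_mul]
  · rw [delta_of_not h]
    by_cases h1 : ∀ i i', (j i).1 = (j i').1
    · rw [delta_of_not fun h2 => h fun i i' => Prod.ext (h1 i i') (h2 i i'), mul_zero]
    · rw [delta_of_not h1, zero_mul]

/-- The array `T` can be diagonalised with diagonal entries `1` indexed by `J`. -/
def Diag (T : (∀ i, ι i) → K) (J : Type*) : Prop :=
  ∃ φ : ∀ i, J → ι i → K, ∀ j : Fin k → J, contract K T (fun i => φ i (j i)) = delta K j

theorem Diag.comap {T : (∀ i, ι i) → K} {J J' : Type*} (h : Diag T J) (f : J' → J)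
    (hf : Function.Injective f) : Diag T J' := by
  obtain ⟨φ, hφ⟩ := h
  refine ⟨fun i j => φ i (f j), fun j => ?_⟩
  rw [hφ fun i => f (j i)]
  exact delta_congr (by simp [hf.eq_iff])

theorem Diag.boxProd {T : (∀ i, ι i) → K} {S : (∀ i, κ i) → K} {J J' : Type*} (h : Diag T J)
    (h' : Diag S J') : Diag (boxProd T S) (J × J') := by
  obtain ⟨φ, hφ⟩ := h
  obtain ⟨ψ, hψ⟩ := h'
  refine ⟨fun i j z => φ i j.1 z.1 * ψ i j.2 z.2, fun j => ?_⟩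
  rw [contract_boxProd, hφ fun i => (j i).1, hψ fun i => (j i).2, delta_prod]

theorem Diag.reindex {T : (∀ i, ι i) → K} {S : (∀ i, κ i) → K} {J : Type*} (h : Diag T J)
    (e : ∀ i, κ i ≃ ι i) (hS : ∀ y, S y = T fun i => e i (y i)) : Diag S J := by
  obtain ⟨φ, hφ⟩ := h
  refine ⟨fun i j y => φ i j (e i y), fun j => ?_⟩
  rw [← hφ, contract_apply_self, contract_apply_self, ← (Equiv.piCongrRight e).sum_comp]
  simp only [hS]
  rfl

omit [∀ i, Fintype (ι i)] in
theorem boxPow_add (T : (∀ i, ι i) → K) (N M : ℕ) (y : ∀ i, Fin (N + M) → ι i) :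
    boxPow T (N + M) y =
      boxProd (boxPow T N) (boxPow T M) fun i => (Fin.appendEquiv N M).symm (y i) := by
  simp [boxPow, boxProd, Fin.prod_univ_add, Fin.appendEquiv]

theorem Diag.boxPow_add {T : (∀ i, ι i) → K} {N M : ℕ} {J : Type*}
    (h : Diag (KTensor.boxProd (boxPow T N) (boxPow T M)) J) : Diag (boxPow T (N + M)) J :=
  h.reindex (fun _ => (Fin.appendEquiv N M).symm) fun y => KTensor.boxPow_add T N M y

theorem toArray_tprod [∀ i, DecidableEq (ι i)] (v : ∀ i, ι i → K) (x : ∀ i, ι i) :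
    toArray (PiTensorProduct.tprod K v) x = ∏ i, v i (x i) := by
  simp [toArray]

theorem toArray_unitTensor (hk : 0 < k) (r : ℕ) (j : Fin k → Fin r) :
    toArray (unitTensor K k r) j = delta K j := by
  classical
  simp only [unitTensor, map_sum, Finset.sum_apply, toArray_tprod, Pi.single_apply]
  simp only [Finset.prod_ite_zero, Finset.prod_const_one, Finset.mem_univ, true_implies, delta]
  split_ifs with h
  · rw [Finset.sum_eq_single (j ⟨0, hk⟩)]
    · rw [if_pos fun i => h _ _]
    · intro b _ hb
      rw [if_neg fun h' => hb (h' _).symm]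
    · simp
  · refine Finset.sum_eq_zero fun b _ => if_neg fun h' => h fun i i' => ?_
    rw [h', h']

theorem toArray_map (T : ⨂[K] i, (ι i → K)) [∀ i, DecidableEq (ι i)]
    (π : ∀ i, (ι i → K) →ₗ[K] (κ i → K)) (y : ∀ i, κ i) :
    toArray (PiTensorProduct.map π T) y =
      contract K (toArray T) fun i x => π i (Pi.single x 1) (y i) := by
  classical
  have h : ∀ T : ⨂[K] i, (ι i → K), T = ∑ x, toArray T x •
      PiTensorProduct.tprod K fun i => (Pi.single (x i) 1 : ι i → K) := by
    intro T
    conv_lhs => rw [← (Basis.piTensorProduct fun i => Pi.basisFun K (ι i)).sum_equivFun T]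
    simp [toArray]
  conv_lhs => rw [h T]
  simp only [map_sum, map_smul, PiTensorProduct.map_tprod, Finset.sum_apply, Pi.smul_apply,
    toArray_tprod, contract_apply_self, smul_eq_mul]

theorem restricts_unitTensor_iff (hk : 0 < k) (T : ⨂[K] i, (ι i → K)) (r : ℕ) :
    Restricts T (unitTensor K k r) ↔ Diag (toArray T) (Fin r) := by
  classical
  constructor
  · rintro ⟨π, hπ⟩
    refine ⟨fun i j x => π i (Pi.single x 1) j, fun j => ?_⟩
    rw [← toArray_unitTensor hk, ← hπ, toArray_map]
  · rintro ⟨φ, hφ⟩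
    refine ⟨fun i => (LinearMap.pi fun j => ∑ x, φ i j x • LinearMap.proj x), ?_⟩
    refine toArray.injective (funext fun j => ?_)
    rw [toArray_unitTensor hk, toArray_map, ← hφ]
    simp [Pi.single_apply]

theorem toArray_kroneckerPow (T : ⨂[K] i, (ι i → K)) (N : ℕ) :
    toArray (kroneckerPow T N) = boxPow (toArray T) N := by
  rw [kroneckerPow, LinearEquiv.apply_symm_apply]
  rfl

/-- Contracting the other directions with their vectors of index `s` gives a functional that reads
off the coefficient of `φ i₀ s`, so the vectors `φ i₀` are linearly independent. A second direction
is needed for this. -/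
theorem Diag.le_card (hk : 2 ≤ k) {T : (∀ i, ι i) → K} {r : ℕ} (h : Diag T (Fin r))
    (i₀ : Fin k) : r ≤ Fintype.card (ι i₀) := by
  classical
  obtain ⟨φ, hφ⟩ := h
  have hli : LinearIndependent K (φ i₀) := by
    rw [Fintype.linearIndependent_iff]
    intro c hc s
    have h1 : contract K T (Function.update (fun i => φ i s) i₀ (∑ j, c j • φ i₀ j)) = c s := by
      rw [MultilinearMap.map_update_sum]
      simp only [MultilinearMap.map_update_smul]
      rw [Finset.sum_eq_single s]
      · rw [Function.update_eq_self i₀ (fun i => φ i s), hφ fun _ => s]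
        simp [delta_of_forall]
      · intro b _ hb
        have h2 : Function.update (fun i => φ i s) i₀ (φ i₀ b) =
            fun i => φ i (Function.update (fun _ => s) i₀ b i) := by
          funext i
          by_cases hi : i = i₀
          · subst hi; simp
          · simp [hi]
        have : Nontrivial (Fin k) := Fin.nontrivial_iff_two_le.2 hk
        obtain ⟨i₁, hi₁⟩ := exists_ne i₀
        rw [h2, hφ, delta_of_not, smul_zero]
        intro h3
        have := h3 i₀ i₁
        simp [hi₁, hb] at this
      · simp
    rw [← h1, hc]
    exact MultilinearMap.map_update_zero _ _ _
  simpa using hli.fintype_card_le_finrank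

theorem subrank_eq_sSup (hk : 0 < k) (T : ⨂[K] i, (ι i → K)) :
    subrank T = sSup {r : ℕ | Diag (toArray T) (Fin r)} := by
  simp only [subrank, restricts_unitTensor_iff hk]

theorem le_subrank (hk : 2 ≤ k) {T : ⨂[K] i, (ι i → K)} {r : ℕ}
    (h : Diag (toArray T) (Fin r)) : r ≤ subrank T := by
  rw [subrank_eq_sSup (by lia)]
  exact le_csSup ⟨_, fun r hr => Diag.le_card hk hr ⟨0, by lia⟩⟩ h

theorem diag_zero (hk : 0 < k) (T : (∀ i, ι i) → K) : Diag T (Fin 0) :=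
  ⟨fun _ j => j.elim0, fun j => (j ⟨0, hk⟩).elim0⟩

theorem diag_subrank (hk : 2 ≤ k) (T : ⨂[K] i, (ι i → K)) :
    Diag (toArray T) (Fin (subrank T)) := by
  rw [subrank_eq_sSup (by lia)]
  exact Nat.sSup_mem (s := {r : ℕ | Diag (toArray T) (Fin r)}) ⟨0, diag_zero (by lia) _⟩
    ⟨_, fun r hr => Diag.le_card hk hr ⟨0, by lia⟩⟩

theorem subrank_le_card (hk : 2 ≤ k) (T : ⨂[K] i, (ι i → K)) (i : Fin k) :
    subrank T ≤ Fintype.card (ι i) :=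
  (diag_subrank hk T).le_card hk i

theorem diag_one (hk : 0 < k) {T : (∀ i, ι i) → K} (hT : T ≠ 0) : Diag T (Fin 1) := by
  classical
  obtain ⟨y, hy⟩ := Function.ne_iff.1 hT
  refine ⟨fun i _ => Function.update (fun i => (Pi.single (y i) 1 : ι i → K)) ⟨0, hk⟩
    ((T y)⁻¹ • Pi.single (y ⟨0, hk⟩) 1) i, fun j => ?_⟩
  rw [delta_of_forall fun _ _ => Subsingleton.elim _ _]
  change contract K T (Function.update (fun i => (Pi.single (y i) 1 : ι i → K)) ⟨0, hk⟩
    ((T y)⁻¹ • Pi.single (y ⟨0, hk⟩) 1)) = 1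
  rw [MultilinearMap.map_update_smul,
    Function.update_eq_self (⟨0, hk⟩ : Fin k) (fun i => (Pi.single (y i) 1 : ι i → K)),
    contract_single]
  exact inv_mul_cancel₀ hy

omit [∀ i, Fintype (ι i)] in
theorem boxPow_ne_zero {T : (∀ i, ι i) → K} (hT : T ≠ 0) (N : ℕ) : boxPow T N ≠ 0 := by
  obtain ⟨y, hy⟩ := Function.ne_iff.1 hT
  refine Function.ne_iff.2 ⟨fun i _ => y i, ?_⟩
  exact Finset.prod_ne_zero_iff.2 fun _ _ => hy

theorem subrank_pos (hk : 2 ≤ k) {T : ⨂[K] i, (ι i → K)} (hT : T ≠ 0) (N : ℕ) :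
    1 ≤ subrank (kroneckerPow T N) := by
  refine le_subrank hk (diag_one (by lia) ?_)
  rw [toArray_kroneckerPow]
  exact boxPow_ne_zero (by simpa using hT) N

theorem subrank_mul_le (hk : 2 ≤ k) (T : ⨂[K] i, (ι i → K)) (N M : ℕ) :
    subrank (kroneckerPow T N) * subrank (kroneckerPow T M) ≤
      subrank (kroneckerPow T (N + M)) := by
  refine le_subrank hk ?_
  have h1 := diag_subrank hk (kroneckerPow T N)
  have h2 := diag_subrank hk (kroneckerPow T M)
  rw [toArray_kroneckerPow] at h1 h2 ⊢
  exact (h1.boxProd h2).boxPow_add.comap finProdFinEquiv.symm finProdFinEquiv.symm.injective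

end Contraction

/-! ### Existence of the limit by Fekete's lemma -/

section Limit

variable {K : Type*} [Field K] {k : ℕ} {ι : Fin k → Type*} [∀ i, Fintype (ι i)]

/-- The asymptotic subrank is a limit, and bounds the subranks of all powers. -/
theorem exists_tendsto_subrank (hk : 2 ≤ k) {T : ⨂[K] i, (ι i → K)} (hT : T ≠ 0) :
    ∃ q : ℝ, 1 ≤ q ∧ Filter.Tendsto
      (fun N : ℕ => (subrank (kroneckerPow T N) : ℝ) ^ (1 / (N : ℝ))) Filter.atTop (𝓝 q) ∧
      ∀ N : ℕ, 0 < N → (subrank (kroneckerPow T N) : ℝ) ≤ q ^ N := by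
  set Q : ℕ → ℝ := fun N => (subrank (kroneckerPow T N) : ℝ) with hQ
  have hQ1 : ∀ N, 1 ≤ Q N := fun N => by
    simpa [hQ] using subrank_pos hk hT N
  have hQ0 : ∀ N, 0 < Q N := fun N => one_pos.trans_le (hQ1 N)
  -- Subranks are supermultiplicative, so Fekete's lemma applies to the negative logarithms.
  have hsub : Subadditive fun N => -Real.log (Q N) := by
    intro N M
    have h : Q N * Q M ≤ Q (N + M) := by
      simp only [hQ]
      exact_mod_cast subrank_mul_le hk T N M
    have := Real.log_le_log (mul_pos (hQ0 N) (hQ0 M)) h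
    rw [Real.log_mul (hQ0 N).ne' (hQ0 M).ne'] at this
    linarith
  have hbdd : BddBelow (Set.range fun N : ℕ => -Real.log (Q N) / N) := by
    have i₀ : Fin k := ⟨0, by lia⟩
    refine ⟨-|Real.log (Fintype.card (ι i₀))|, ?_⟩
    rintro _ ⟨N, rfl⟩
    rcases Nat.eq_zero_or_pos N with rfl | hN
    · simp
    have hN' : (0 : ℝ) < N := by exact_mod_cast hN
    rw [le_div_iff₀ hN']
    have h1 : Q N ≤ (Fintype.card (ι i₀) : ℝ) ^ N := by
      have := subrank_le_card hk (kroneckerPow T N) i₀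
      rw [Fintype.card_fun, Fintype.card_fin] at this
      simp only [hQ]
      exact_mod_cast this
    have h2 := Real.log_le_log (hQ0 N) h1
    rw [Real.log_pow] at h2
    have h3 := mul_le_mul_of_nonneg_left (le_abs_self (Real.log (Fintype.card (ι i₀)))) hN'.le
    linarith
  have hlim := hsub.tendsto_lim hbdd
  refine ⟨Real.exp (-hsub.lim), ?_, ?_, ?_⟩
  · rw [Real.one_le_exp_iff, neg_nonneg]
    refine le_of_tendsto hlim (Filter.Eventually.of_forall fun N => ?_)
    exact div_nonpos_of_nonpos_of_nonneg (neg_nonpos.2 (Real.log_nonneg (hQ1 N)))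
      (Nat.cast_nonneg _)
  · refine ((Real.continuous_exp.tendsto _).comp hlim.neg).congr fun N => ?_
    simp only [Function.comp]
    change _ = Q N ^ (1 / (N : ℝ))
    rw [Real.rpow_def_of_pos (hQ0 N)]
    congr 1
    ring
  · intro N hN
    have h := hsub.lim_le_div hbdd hN.ne'
    have hN' : (0 : ℝ) < N := by exact_mod_cast hN
    rw [le_div_iff₀ hN'] at h
    rw [← Real.exp_nat_mul]
    change Q N ≤ _
    rw [← Real.log_le_iff_le_exp (hQ0 N)]
    linarith

end Limit

/-! ### The exchange identity and reduction to pairs of directions -/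

section Exchange

variable {K : Type*} [Field K] {k : ℕ} {V : Fin k → Type*} [∀ i, AddCommGroup (V i)]
  [∀ i, Module K (V i)]

/-- The values of a multilinear form satisfy the exchange identity of a form that factors with
respect to the sets `A` and `B` of variables. -/
def Exch (f : MultilinearMap K V K) (A B : Finset (Fin k)) : Prop :=
  ∀ a c : ∀ i, V i, f a * f ((A ∪ B).piecewise c a) = f (A.piecewise c a) * f (B.piecewise c a)

theorem Exch.symm {f : MultilinearMap K V K} {A B : Finset (Fin k)} (h : Exch f A B) :
    Exch f B A := fun a c => by rw [Finset.union_comm, h a c, mul_comm]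

theorem exch_empty (f : MultilinearMap K V K) (B : Finset (Fin k)) : Exch f ∅ B :=
  fun a c => by rw [Finset.empty_union, Finset.piecewise_empty]

omit [∀ i, AddCommGroup (V i)] in
theorem piecewise_update_of_notMem {S : Finset (Fin k)} {i : Fin k} (hi : i ∉ S)
    (a c : ∀ i, V i) (v : V i) :
    S.piecewise c (Function.update a i v) = Function.update (S.piecewise c a) i v := by
  funext l
  by_cases hl : l = i
  · subst hl; simp [hi]
  · by_cases hS : l ∈ S <;> simp [hl, hS]

theorem apply_piecewise_update (f : MultilinearMap K V K) (a c : ∀ i, V i) {i : Fin k}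
    (S : Finset (Fin k)) (hi : i ∉ S) :
    f (S.piecewise c (Function.update a i (c i))) = f ((insert i S).piecewise c a) := by
  rw [piecewise_update_of_notMem hi, Finset.piecewise_insert]

theorem apply_piecewise_update_add (f : MultilinearMap K V K) (a c : ∀ i, V i) {i : Fin k}
    (S : Finset (Fin k)) (hi : i ∉ S) :
    f (S.piecewise c (Function.update a i (a i + c i))) =
      f (S.piecewise c a) + f ((insert i S).piecewise c a) := by
  rw [piecewise_update_of_notMem hi, MultilinearMap.map_update_add, Finset.piecewise_insert]
  congr 2
  rw [Function.update_eq_self_iff]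
  simp [hi]

/-- Proportionality passes from index 0 to index 3 through a nonzero entry at index 1 or 2. If all
four of these entries vanish, only the polarised relation `h₅` remains, and it then is the claim. -/
theorem eq_mul_of_proportional {a₀ a₁ a₂ a₃ b₀ b₁ b₂ b₃ : K} (h₁ : a₀ * b₁ = a₁ * b₀)
    (h₂ : a₂ * b₃ = a₃ * b₂) (h₃ : a₀ * b₂ = a₂ * b₀) (h₄ : a₁ * b₃ = a₃ * b₁)
    (h₅ : (a₀ + a₂) * (b₁ + b₃) = (a₁ + a₃) * (b₀ + b₂)) : a₀ * b₃ = a₃ * b₀ := by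
  by_cases ha₁ : a₁ = 0
  · by_cases hb₁ : b₁ = 0
    · by_cases ha₂ : a₂ = 0
      · by_cases hb₂ : b₂ = 0
        · subst ha₁ hb₁ ha₂ hb₂
          linear_combination h₅
        · refine mul_left_cancel₀ hb₂ ?_
          linear_combination b₃ * h₃ + b₀ * h₂
      · refine mul_left_cancel₀ ha₂ ?_
        linear_combination a₀ * h₂ + a₃ * h₃
    · refine mul_left_cancel₀ hb₁ ?_
      linear_combination b₃ * h₁ + b₀ * h₄
  · refine mul_left_cancel₀ ha₁ ?_
    linear_combination a₀ * h₄ + a₃ * h₁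

/-- The entries `a₀, …, a₃` of `eq_mul_of_proportional` are the values with nothing, `A`, `i`, or
both switched to `c`; the `b`'s have `B` switched as well. The polarised relation comes from putting
`a i + c i` in direction `i`. -/
theorem Exch.insert {f : MultilinearMap K V K} {A B : Finset (Fin k)} {i : Fin k}
    (hA : Exch f A B) (hi : Exch f {i} B) (hiA : i ∉ A) (hiB : i ∉ B) :
    Exch f (insert i A) B := by
  intro a c
  have hiAB : i ∉ A ∪ B := by simp [hiA, hiB]
  have hpair := apply_piecewise_update f a c (i := i)
  have hadd := apply_piecewise_update_add f a c (i := i)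
  have hpw : ∀ S S' : Finset (Fin k), S.piecewise c (S'.piecewise c a) =
      (S ∪ S').piecewise c a := by
    intro S S'
    funext l
    by_cases h1 : l ∈ S <;> by_cases h2 : l ∈ S' <;> simp [h1, h2]
  have h1 := hA a c
  have h2 := hA (Function.update a i (c i)) c
  have h3 := hi a c
  have h4 := hi (A.piecewise c a) c
  have h5 := hA (Function.update a i (a i + c i)) c
  have e1 := hpair ∅ (by simp)
  have e2 := hadd ∅ (by simp)
  rw [Finset.piecewise_empty] at e1 e2
  rw [Finset.piecewise_empty] at e2
  rw [e1, hpair _ hiAB, hpair _ hiA, hpair _ hiB] at h2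
  rw [e2, hadd _ hiAB, hadd _ hiA, hadd _ hiB] at h5
  rw [hpw, hpw, hpw] at h4
  have s1 : {i} ∪ B ∪ A = Insert.insert i (A ∪ B) := by grind
  have s2 : {i} ∪ A = Insert.insert i A := by grind
  have s3 : {i} ∪ B = Insert.insert i B := by grind
  have s4 : Insert.insert i A ∪ B = Insert.insert i (A ∪ B) := by grind
  rw [s1, s2, Finset.union_comm B A] at h4
  rw [s3] at h3
  rw [s4]
  have s5 : ({i} : Finset (Fin k)) = Insert.insert i ∅ := by simp
  rw [s5] at h3
  exact eq_mul_of_proportional h1 h2 h3 h4 h5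

theorem exch_of_forall_singleton {f : MultilinearMap K V K} {A B : Finset (Fin k)}
    (hAB : Disjoint A B) (h : ∀ i ∈ A, ∀ j ∈ B, Exch f {i} {j}) : Exch f A B := by
  have key : ∀ (S S' : Finset (Fin k)), Disjoint S S' → (∀ i ∈ S, Exch f {i} S') →
      Exch f S S' := by
    intro S S'
    induction S using Finset.induction_on with
    | empty => exact fun _ _ => exch_empty f S'
    | insert i S hi ih =>
      intro hd hS
      rw [Finset.disjoint_insert_left] at hd
      exact (ih hd.2 fun l hl => hS l (Finset.mem_insert_of_mem hl)).insert
        (hS i (Finset.mem_insert_self _ _)) hi hd.1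
  refine key A B hAB fun i hi => (key B {i} ?_ fun j hj => (h i hi j hj).symm).symm
  rw [Finset.disjoint_singleton_right]
  exact Finset.disjoint_left.1 hAB hi

/-- If two variables of a multilinear form violate the exchange identity, then the form restricts
to a `2 × 2` identity matrix in these two variables. -/
theorem exists_of_not_exch {f : MultilinearMap K V K} {i j : Fin k} (hij : i ≠ j)
    (h : ¬Exch f {i} {j}) : ∃ ψ : ∀ l, Fin 2 → V l, ∀ b : Fin k → Fin 2,
      f (fun l => ψ l (b l)) = if b i = b j then 1 else 0 := by
  obtain ⟨a, h⟩ := not_forall.1 h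
  obtain ⟨c, h⟩ := not_forall.1 h
  set m00 := f a with hm00
  set m11 := f (({i} ∪ {j} : Finset (Fin k)).piecewise c a) with hm11
  set m10 := f (({i} : Finset (Fin k)).piecewise c a) with hm10
  set m01 := f (({j} : Finset (Fin k)).piecewise c a) with hm01
  have hdet : m00 * m11 - m10 * m01 ≠ 0 := sub_ne_zero.2 h
  set D := m00 * m11 - m10 * m01 with hD
  -- With the other directions frozen at `a`, the form has an invertible 2 × 2 matrix on the spans
  -- in directions `i` and `j`; its inverse is applied in direction `i`.
  let p : Fin 2 → V i := ![D⁻¹ • (m11 • a i + (-m01) • c i), D⁻¹ • (m00 • c i + (-m10) • a i)]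
  let r : Fin 2 → V j := ![a j, c j]
  refine ⟨fun l s => Function.update (Function.update a j (r s)) i (p s) l, fun b => ?_⟩
  have e0 : (fun l => Function.update (Function.update a j (r (b l))) i (p (b l)) l) =
      Function.update (Function.update a j (r (b j))) i (p (b i)) := by
    funext l
    by_cases h1 : l = i
    · subst h1; simp
    · by_cases h2 : l = j
      · subst h2; simp [h1]
      · simp [h1, h2]
  rw [e0]
  have f00 : f (Function.update (Function.update a j (a j)) i (a i)) = m00 := by simp [hm00]
  have f10 : f (Function.update (Function.update a j (a j)) i (c i)) = m10 := by
    simp [hm10, Finset.piecewise_singleton]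
  have f01 : f (Function.update (Function.update a j (c j)) i (a i)) = m01 := by
    rw [hm01, Finset.piecewise_singleton]
    congr 1
    rw [Function.update_eq_self_iff]
    simp [hij]
  have f11 : f (Function.update (Function.update a j (c j)) i (c i)) = m11 := by
    rw [hm11, Finset.singleton_union, Finset.piecewise_insert, Finset.piecewise_singleton]
  have hb : ∀ s : Fin 2, s = 0 ∨ s = 1 := by decide
  rcases hb (b i) with h1 | h1 <;> rcases hb (b j) with h2 | h2 <;> rw [h1, h2] <;>
    simp only [p, r, Matrix.cons_val_zero, Matrix.cons_val_one, MultilinearMap.map_update_smul,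
      MultilinearMap.map_update_add, f00, f01, f10, f11, smul_eq_mul]
  · rw [if_pos trivial, ← inv_mul_cancel₀ hdet, hD]
    ring
  · rw [if_neg (by decide)]
    ring
  · rw [if_neg (by decide)]
    ring
  · rw [if_pos trivial, ← inv_mul_cancel₀ hdet, hD]
    ring

end Exchange

/-! ### Tensors that split along a bipartition -/

section Product

variable {K : Type*} [Field K] {k : ℕ} {ι : Fin k → Type*} [∀ i, Fintype (ι i)]

theorem mul_eq_of_exch {T : (∀ i, ι i) → K} {A : Finset (Fin k)}
    (h : Exch (contract K T) A Aᶜ) (x y : ∀ i, ι i) :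
    T x * T y = T (A.piecewise y x) * T (Aᶜ.piecewise y x) := by
  classical
  have h1 := h (fun i => Pi.single (x i) 1) (fun i => Pi.single (y i) 1)
  have h2 : ∀ S : Finset (Fin k), S.piecewise (fun i => (Pi.single (y i) 1 : ι i → K))
      (fun i => Pi.single (x i) 1) = fun i => Pi.single (S.piecewise y x i) 1 := by
    intro S
    funext i
    by_cases hi : i ∈ S <;> simp [hi]
  rw [Finset.union_compl, h2, h2, h2, contract_single, contract_single, contract_single,
    contract_single, Finset.piecewise_univ] at h1
  exact h1

/-- Swapping the `A`-parts of a pair of multi-indices is an involution that matches the terms of the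
two double sums. Together with `mul_eq_of_exch` this reduces splitting to coefficients, where it
visibly passes to powers. -/
theorem exch_of_mul_eq {T : (∀ i, ι i) → K} {A : Finset (Fin k)}
    (h : ∀ x y : ∀ i, ι i, T x * T y = T (A.piecewise y x) * T (Aᶜ.piecewise y x)) :
    Exch (contract K T) A Aᶜ := by
  intro a c
  rw [Finset.union_compl, Finset.piecewise_univ]
  simp only [contract_apply_self, Finset.sum_mul_sum, ← Fintype.sum_prod_type']
  have hinv : Function.Involutive fun p : (∀ i, ι i) × (∀ i, ι i) =>
      (A.piecewise p.2 p.1, Aᶜ.piecewise p.2 p.1) := by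
    intro p
    ext i
    all_goals by_cases hi : i ∈ A <;> simp [hi]
  refine Fintype.sum_equiv hinv.toPerm _ _ fun p => ?_
  simp only [Function.Involutive.coe_toPerm]
  rw [mul_mul_mul_comm (T p.1), mul_mul_mul_comm (T (A.piecewise p.2 p.1)), h p.1 p.2,
    ← Finset.prod_mul_distrib, ← Finset.prod_mul_distrib]
  congr 1
  refine Finset.prod_congr rfl fun i _ => ?_
  by_cases hi : i ∈ A <;> simp [hi, mul_comm]

theorem Exch.boxPow {T : (∀ i, ι i) → K} {A : Finset (Fin k)}
    (h : Exch (contract K T) A Aᶜ) (N : ℕ) : Exch (contract K (boxPow T N)) A Aᶜ := by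
  refine exch_of_mul_eq fun x y => ?_
  simp only [KTensor.boxPow, ← Finset.prod_mul_distrib]
  refine Finset.prod_congr rfl fun l _ => ?_
  rw [mul_eq_of_exch h]
  congr 2 <;> funext i <;> by_cases hi : i ∈ A <;> simp [hi]

/-- A tensor that factors with respect to a bipartition of its directions has subrank at most
one. -/
theorem Diag.le_one_of_exch {T : (∀ i, ι i) → K} {A : Finset (Fin k)}
    (h : Exch (contract K T) A Aᶜ) (hA : A.Nonempty) (hA' : A ≠ Finset.univ) {r : ℕ}
    (hr : Diag T (Fin r)) : r ≤ 1 := by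
  classical
  by_contra! hr1
  obtain ⟨φ, hφ⟩ := hr
  have hpw : ∀ S : Finset (Fin k), S.piecewise (fun i => φ i ⟨1, hr1⟩)
      (fun i => φ i ⟨0, by lia⟩) =
        fun i => φ i (S.piecewise (fun _ => (⟨1, hr1⟩ : Fin r)) (fun _ => ⟨0, by lia⟩) i) := by
    intro S
    funext i
    by_cases hi : i ∈ S <;> simp [hi]
  -- Exchange between diagonal indices 0 and 1 equates a product of two diagonal entries with a
  -- product of off-diagonal ones.
  have h1 := h (fun i => φ i ⟨0, by lia⟩) (fun i => φ i ⟨1, hr1⟩)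
  rw [Finset.union_compl, Finset.piecewise_univ, hpw, hφ, hφ, hφ,
    delta_of_forall fun _ _ => rfl, delta_of_forall fun _ _ => rfl, delta_of_not, zero_mul,
    one_mul] at h1
  · exact one_ne_zero h1
  · intro h2
    obtain ⟨i, hi⟩ := hA
    obtain ⟨i', hi'⟩ : ∃ i', i' ∉ A := by
      by_contra! h3
      exact hA' (Finset.eq_univ_iff_forall.2 h3)
    have := h2 i i'
    simp [hi, hi'] at this

theorem subrank_eq_one_of_exch (hk : 2 ≤ k) {T : ⨂[K] i, (ι i → K)} (hT : T ≠ 0)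
    {A : Finset (Fin k)} (h : Exch (contract K (toArray T)) A Aᶜ) (hA : A.Nonempty)
    (hA' : A ≠ Finset.univ) (N : ℕ) : subrank (kroneckerPow T N) = 1 := by
  refine le_antisymm ?_ (subrank_pos hk hT N)
  have h1 := diag_subrank hk (kroneckerPow T N)
  rw [toArray_kroneckerPow] at h1
  exact h1.le_one_of_exch (h.boxPow N) hA hA'

end Product

/-! ### Unit tensors of constant size in a fixed power -/

section Catalyst

variable {K : Type*} [Field K] {k : ℕ} {ι : Fin k → Type*} [∀ i, Fintype (ι i)]

theorem contract_boxPow_add {R : Type*} [CommRing R] [Algebra K R] (T : (∀ i, ι i) → K)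
    {N M : ℕ} (a : ∀ i, (Fin N → ι i) → R) (b : ∀ i, (Fin M → ι i) → R) :
    contract R (boxPow T (N + M)) (fun i x => a i ((Fin.appendEquiv N M).symm x).1 *
      b i ((Fin.appendEquiv N M).symm x).2) =
      contract R (boxPow T N) a * contract R (boxPow T M) b := by
  rw [← contract_boxProd, contract_apply, contract_apply]
  refine Fintype.sum_equiv (Equiv.piCongrRight fun i => (Fin.appendEquiv N M).symm) _ _
    fun x => ?_
  rw [boxPow_add]
  rfl

/-- If every bipartition of the directions is crossed by a violation of the exchange identity,
then some Kronecker power diagonalises with two diagonal entries. -/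
theorem exists_diag_two (hk : 0 < k) {T : (∀ i, ι i) → K}
    (h : ∀ A : Finset (Fin k), A.Nonempty → A ≠ Finset.univ →
      ∃ i ∈ A, ∃ j ∉ A, ¬Exch (contract K T) {i} {j}) :
    ∃ m, Diag (boxPow T m) (Fin 2) := by
  classical
  -- A spanning tree of violating pairs is grown. Each edge contributes one factor of `T`,
  -- restricted to an identity matrix that forces its two end indices to agree.
  have key : ∀ s : ℕ, s < k → ∃ S : Finset (Fin k), S.card = s + 1 ∧ ∃ m,
      ∃ φ : ∀ i, Fin 2 → (Fin m → ι i) → K, ∀ b : Fin k → Fin 2,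
        contract K (boxPow T m) (fun i => φ i (b i)) =
          if ∀ i ∈ S, ∀ i' ∈ S, b i = b i' then 1 else 0 := by
    intro s
    induction s with
    | zero =>
      refine fun _ => ⟨{⟨0, hk⟩}, by simp, 0, fun _ _ _ => 1, fun b => ?_⟩
      rw [if_pos (by simp)]
      simpa using contract_boxPow (R := K) T (N := 0) (fun l => l.elim0)
    | succ s ih =>
      intro hs
      obtain ⟨S, hS, m, φ, hφ⟩ := ih (by lia)
      obtain ⟨i, hi, j, hj, hij⟩ := h S (Finset.card_pos.1 (by lia))
        (fun h' => by rw [h', Finset.card_univ, Fintype.card_fin] at hS; lia)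
      obtain ⟨ψ, hψ⟩ := exists_of_not_exch (ne_of_mem_of_not_mem hi hj) hij
      refine ⟨insert j S, by rw [Finset.card_insert_of_notMem hj, hS], m + 1,
        fun l s x => φ l s ((Fin.appendEquiv m 1).symm x).1 *
          ψ l s (((Fin.appendEquiv m 1).symm x).2 0), fun b => ?_⟩
      have h1 := contract_boxPow (R := K) T (N := 1) (fun _ l => ψ l (b l))
      simp only [Finset.univ_unique, Finset.prod_singleton, Fin.default_eq_zero] at h1
      rw [contract_boxPow_add T (fun l => φ l (b l)) (fun l x => ψ l (b l) (x 0)), hφ, h1, hψ]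
      by_cases h2 : ∀ l ∈ S, ∀ l' ∈ S, b l = b l'
      · rw [if_pos h2, one_mul]
        refine if_congr ?_ rfl rfl
        constructor
        · intro h3 l hl l' hl'
          have h4 : ∀ l ∈ insert j S, b l = b i := by
            intro l hl
            rcases Finset.mem_insert.1 hl with rfl | hl
            · exact h3.symm
            · exact h2 _ hl _ hi
          rw [h4 l hl, h4 l' hl']
        · exact fun h3 => h3 _ (Finset.mem_insert_of_mem hi) _ (Finset.mem_insert_self _ _)
      · rw [if_neg h2, zero_mul, if_neg]
        exact fun h3 => h2 fun l hl l' hl' => h3 _ (Finset.mem_insert_of_mem hl) _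
          (Finset.mem_insert_of_mem hl')
  obtain ⟨S, hS, m, φ, hφ⟩ := key (k - 1) (by lia)
  have hS' : S = Finset.univ := by
    rw [← Finset.card_eq_iff_eq_univ, Fintype.card_fin]
    lia
  refine ⟨m, φ, fun b => ?_⟩
  rw [hφ, hS', delta]
  simp

theorem Diag.exists_of_two {T : (∀ i, ι i) → K} (hk : 0 < k) {m : ℕ}
    (h : Diag (boxPow T m) (Fin 2)) (J : Type*) [Finite J] : ∃ m', Diag (boxPow T m') J := by
  have key : ∀ s : ℕ, Diag (boxPow T (m * s)) (Fin (2 ^ s)) := by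
    intro s
    induction s with
    | zero => exact (diag_one hk (T := boxPow T 0) (Function.ne_iff.2
        ⟨fun _ l => l.elim0, by simp [boxPow]⟩) :)
    | succ s ih =>
      rw [Nat.mul_succ, pow_succ]
      exact (ih.boxProd h).boxPow_add.comap finProdFinEquiv.symm finProdFinEquiv.symm.injective
  obtain ⟨n, ⟨e⟩⟩ := Finite.exists_equiv_fin J
  exact ⟨m * n, (key n).comap (fun j => Fin.castLE Nat.lt_two_pow_self.le (e j))
    ((Fin.castLE_injective _).comp e.injective)⟩

end Catalyst

/-! ### A zero with nonvanishing partial contractions -/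

section Generic

variable {K : Type*} [Field K] {k : ℕ} {ι : Fin k → Type*} [∀ i, Fintype (ι i)]

theorem not_exch_contract_of_algebra (L : Type*) [Field L] [Algebra K L] {T : (∀ i, ι i) → K}
    {A B : Finset (Fin k)} (h : ¬Exch (contract K T) A B) : ¬Exch (contract L T) A B := by
  intro h'
  refine h fun a c => (algebraMap K L).injective ?_
  have h1 := h' (fun i x => algebraMap K L (a i x)) (fun i x => algebraMap K L (c i x))
  have h2 : ∀ S : Finset (Fin k), S.piecewise (fun i x => algebraMap K L (c i x))
      (fun i x => algebraMap K L (a i x)) = fun i x => algebraMap K L (S.piecewise c a i x) := by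
    intro S
    funext i
    by_cases hi : i ∈ S <;> simp [hi]
  have h3 := fun a : ∀ i, ι i → K => map_contract (Algebra.ofId K L) T a
  simp only [Algebra.ofId_apply] at h3
  rw [h2, h2, h2, ← h3, ← h3, ← h3, ← h3] at h1
  simpa using h1

/-- Over an infinite field, finitely many violable exchange identities can be violated
simultaneously. -/
theorem exists_forall_not_exch {L : Type*} [Field L] [Infinite L] [Algebra K L]
    {T : (∀ i, ι i) → K} (I : Finset (Finset (Fin k) × Finset (Fin k)))
    (hI : ∀ p ∈ I, ¬Exch (contract L T) p.1 p.2) :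
    ∃ a c : ∀ i, ι i → L, ∀ p ∈ I, contract L T a * contract L T ((p.1 ∪ p.2).piecewise c a) ≠
      contract L T (p.1.piecewise c a) * contract L T (p.2.piecewise c a) := by
  classical
  -- Each minor is a polynomial in the coordinates of `a` and `c`. It is nonzero by assumption, and
  -- a nonzero product of polynomials does not vanish everywhere over an infinite field.
  let R := MvPolynomial (Bool × Σ i, ι i) L
  let Xa : ∀ i, ι i → R := fun i x => MvPolynomial.X (false, ⟨i, x⟩)
  let Xc : ∀ i, ι i → R := fun i x => MvPolynomial.X (true, ⟨i, x⟩)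
  let g : Finset (Fin k) → R := fun S => contract R T (S.piecewise Xc Xa)
  let F : Finset (Fin k) × Finset (Fin k) → R := fun p => g ∅ * g (p.1 ∪ p.2) - g p.1 * g p.2
  have hg : ∀ (v : Bool × (Σ i, ι i) → L) (S : Finset (Fin k)), MvPolynomial.eval v (g S) =
      contract L T (S.piecewise (fun i x => v (true, ⟨i, x⟩)) fun i x => v (false, ⟨i, x⟩)) := by
    intro v S
    have := map_contract ((MvPolynomial.aeval v).restrictScalars K : R →ₐ[K] L) T
      (S.piecewise Xc Xa)
    rw [AlgHom.restrictScalars_apply, MvPolynomial.aeval_eq_eval] at this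
    refine this.trans ?_
    congr 1
    funext i x
    by_cases hi : i ∈ S <;> simp [hi, Xa, Xc]
  have hF : ∀ (v : Bool × (Σ i, ι i) → L) p, MvPolynomial.eval v (F p) =
      MvPolynomial.eval v (g ∅) * MvPolynomial.eval v (g (p.1 ∪ p.2)) -
        MvPolynomial.eval v (g p.1) * MvPolynomial.eval v (g p.2) := by
    intro v p
    simp [F]
  have hne : ∏ p ∈ I, F p ≠ 0 := by
    refine Finset.prod_ne_zero_iff.2 fun p hp h0 => hI p hp fun a c => ?_
    have h1 := hF (fun s => if s.1 then c s.2.1 s.2.2 else a s.2.1 s.2.2) p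
    rw [h0, map_zero, hg, hg, hg, hg] at h1
    simp only [if_true, Bool.false_eq_true, if_false, Finset.piecewise_empty] at h1
    exact (sub_eq_zero.1 h1.symm)
  obtain ⟨v, hv⟩ : ∃ v, MvPolynomial.eval v (∏ p ∈ I, F p) ≠ 0 := by
    by_contra! h0
    exact hne (MvPolynomial.funext fun v => by rw [h0 v, map_zero])
  rw [map_prod] at hv
  refine ⟨fun i x => v (false, ⟨i, x⟩), fun i x => v (true, ⟨i, x⟩), fun p hp => ?_⟩
  have h1 := Finset.prod_ne_zero_iff.1 hv p hp
  rw [hF, hg, hg, hg, hg, Finset.piecewise_empty] at h1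
  exact sub_ne_zero.1 h1

theorem mul_eq_zero_of_minors {F : Type*} [Field F] {t₀ t₁ t₂ t₃ t₁₂ t₂₃ t₁₃ t₁₂₃ : F}
    (h₁ : t₀ * t₁₃ = t₁ * t₃) (h₂ : t₂ * t₁₂₃ = t₁₂ * t₂₃)
    (h₃ : (t₀ + t₂) * (t₁₃ + t₁₂₃) = (t₁ + t₁₂) * (t₃ + t₂₃)) :
    (t₀ * t₁₂ - t₁ * t₂) * (t₀ * t₂₃ - t₂ * t₃) = 0 := by
  linear_combination -t₀ ^ 2 * h₂ - t₂ ^ 2 * h₁ + t₀ * t₂ * (h₃ - h₁ - h₂)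

/-- If the `{i}, {l}` minors vanished for `a j`, `c j` and `a j + c j` in direction `j`,
`mul_eq_zero_of_minors` would make the product of the two given minors zero. Its subscripts record
which of `i, j, l` are switched to `c`. -/
theorem not_exch_of_ne {L : Type*} [Field L] {V : Fin k → Type*} [∀ i, AddCommGroup (V i)]
    [∀ i, Module L (V i)] {f : MultilinearMap L V L} {i j l : Fin k} (hij : i ≠ j) (hjl : j ≠ l)
    {a c : ∀ i, V i}
    (g₁ : f a * f (({i} ∪ {j} : Finset (Fin k)).piecewise c a) ≠
      f (({i} : Finset (Fin k)).piecewise c a) * f (({j} : Finset (Fin k)).piecewise c a))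
    (g₂ : f a * f (({j} ∪ {l} : Finset (Fin k)).piecewise c a) ≠
      f (({j} : Finset (Fin k)).piecewise c a) * f (({l} : Finset (Fin k)).piecewise c a)) :
    ¬Exch f {i} {l} := by
  intro h
  have h1 := h a c
  have h2 := h (Function.update a j (c j)) c
  have h3 := h (Function.update a j (a j + c j)) c
  have e1 := apply_piecewise_update f a c ∅ (Finset.notMem_empty j)
  have e2 := apply_piecewise_update_add f a c ∅ (Finset.notMem_empty j)
  rw [Finset.piecewise_empty] at e1 e2
  rw [Finset.piecewise_empty] at e2
  have n1 : j ∉ ({i} : Finset (Fin k)) := by simp [hij.symm]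
  have n2 : j ∉ ({l} : Finset (Fin k)) := by simp [hjl]
  have n3 : j ∉ ({i} ∪ {l} : Finset (Fin k)) := by simp [hjl, hij.symm]
  rw [e1, apply_piecewise_update f a c _ n1, apply_piecewise_update f a c _ n2,
    apply_piecewise_update f a c _ n3] at h2
  rw [e2, apply_piecewise_update_add f a c _ n1, apply_piecewise_update_add f a c _ n2,
    apply_piecewise_update_add f a c _ n3] at h3
  have s1 : insert j {i} = ({i} ∪ {j} : Finset (Fin k)) := by grind
  have s2 : insert j {l} = ({j} ∪ {l} : Finset (Fin k)) := by grind
  have s3 : insert j ∅ = ({j} : Finset (Fin k)) := by grind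
  rw [s1, s2, s3] at h2 h3
  exact mul_ne_zero (sub_ne_zero.2 g₁) (sub_ne_zero.2 g₂) (mul_eq_zero_of_minors h1 h2 h3)

theorem not_exch_trans {L : Type*} [Field L] [Infinite L] [Algebra K L]
    {T : (∀ i, ι i) → K} {i j l : Fin k} (hij : i ≠ j) (hjl : j ≠ l)
    (h₁ : ¬Exch (contract L T) {i} {j}) (h₂ : ¬Exch (contract L T) {j} {l}) :
    ¬Exch (contract L T) {i} {l} := by
  obtain ⟨a, c, hac⟩ := exists_forall_not_exch (L := L) (T := T) {({i}, {j}), ({j}, {l})}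
    (by simp [h₁, h₂])
  exact not_exch_of_ne hij hjl (hac ({i}, {j}) (by simp)) (hac ({j}, {l}) (by simp))

theorem not_exch_of_crossing {L : Type*} [Field L] [Infinite L] [Algebra K L]
    {T : (∀ i, ι i) → K} (h : ∀ A : Finset (Fin k), A.Nonempty → A ≠ Finset.univ →
      ∃ i ∈ A, ∃ j ∉ A, ¬Exch (contract L T) {i} {j}) {i j : Fin k} (hij : i ≠ j) :
    ¬Exch (contract L T) {i} {j} := by
  classical
  by_contra! h0
  -- By transitivity no violating pair leaves this set, while `h` provides one because `j` lies
  -- outside.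
  obtain ⟨l, hl, j', hj', hlj⟩ := h {j | i = j ∨ ¬Exch (contract L T) {i} {j}}
    ⟨i, by simp⟩ (fun h1 => by
      have := Finset.mem_univ j
      rw [← h1] at this
      simp [hij, h0] at this)
  simp only [Finset.mem_filter, Finset.mem_univ, true_and, not_or, not_not] at hl hj'
  rcases hl with rfl | hl
  · exact hlj hj'.2
  · by_cases hil : i = l
    · subst hil; exact hlj hj'.2
    · by_cases hlj' : l = j'
      · subst hlj'; exact hl hj'.2
      · exact not_exch_trans hil hlj' hl hlj hj'.2

/-- A tensor that does not factor vanishes, over an infinite field, at a point where no partial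
contraction vanishes. -/
theorem exists_zero_of_not_exch {L : Type*} [Field L] [Infinite L] [Algebra K L] (hk : 2 ≤ k)
    {T : (∀ i, ι i) → K} (h : ∀ i j : Fin k, i ≠ j → ¬Exch (contract L T) {i} {j}) :
    ∃ a b : ∀ i, ι i → L, contract L T a = 0 ∧
      ∀ i, contract L T (Function.update a i (b i)) ≠ 0 := by
  classical
  have hn : Nontrivial (Fin k) := Fin.nontrivial_iff_two_le.2 hk
  let e : Fin k := ⟨0, by lia⟩
  obtain ⟨i₀, hi₀⟩ := exists_ne e
  obtain ⟨a, c, hac⟩ := exists_forall_not_exch (L := L) (T := T)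
    (({e}ᶜ : Finset (Fin k)).image fun i => (({i} : Finset (Fin k)), ({e} : Finset (Fin k))))
    (by simpa using fun i hi => h i e hi)
  have hF : ∀ i, i ≠ e → contract L T a * contract L T (Function.update (Function.update a i (c i))
      e (c e)) ≠ contract L T (Function.update a i (c i)) *
        contract L T (Function.update a e (c e)) := by
    intro i hi
    have := hac ({i}, {e}) (by simp [hi])
    simp only [Finset.piecewise_singleton] at this
    rwa [Finset.union_comm, Finset.singleton_union, Finset.piecewise_insert,
      Finset.piecewise_singleton] at this
  set y : ι e → L := contract L T a • c e + (-contract L T (Function.update a e (c e))) • a e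
    with hy
  obtain ⟨z, hz⟩ : ∃ z : ι e → L, contract L T (Function.update a e z) ≠ 0 := by
    by_contra! h0
    refine hF i₀ hi₀ ?_
    have h1 := h0 (a e)
    rw [Function.update_eq_self] at h1
    rw [h1, h0, zero_mul, mul_zero]
  refine ⟨Function.update a e y, Function.update c e z, ?_, fun i => ?_⟩
  · rw [hy, MultilinearMap.map_update_add, MultilinearMap.map_update_smul,
      MultilinearMap.map_update_smul, Function.update_eq_self, smul_eq_mul, smul_eq_mul]
    ring
  · by_cases hi : i = e
    · subst hi
      simpa using hz
    · rw [Function.update_of_ne hi, Function.update_comm (Ne.symm hi), hy,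
        MultilinearMap.map_update_add, MultilinearMap.map_update_smul,
        MultilinearMap.map_update_smul, smul_eq_mul, smul_eq_mul]
      have h1 : Function.update (Function.update a i (c i)) e (a e) =
          Function.update a i (c i) := by
        rw [Function.update_eq_self_iff, Function.update_of_ne (Ne.symm hi)]
      rw [h1]
      intro h2
      exact hF i hi (by linear_combination h2)

/-- The point of `exists_zero_of_not_exch` can be found over a finite extension. -/
theorem exists_zero_finiteDimensional (hk : 2 ≤ k) {T : (∀ i, ι i) → K}
    (h : ∀ A : Finset (Fin k), A.Nonempty → A ≠ Finset.univ →
      ∃ i ∈ A, ∃ j ∉ A, ¬Exch (contract K T) {i} {j}) :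
    ∃ L : IntermediateField K (AlgebraicClosure K), FiniteDimensional K L ∧
      ∃ a b : ∀ i, ι i → L, contract L T a = 0 ∧
        ∀ i, contract L T (Function.update a i (b i)) ≠ 0 := by
  have : Infinite (AlgebraicClosure K) := IsAlgClosed.instInfinite
  obtain ⟨a, b, ha, hb⟩ := exists_zero_of_not_exch (L := AlgebraicClosure K) hk (T := T)
    fun i j hij => not_exch_of_crossing (fun A hA hA' => by
      obtain ⟨i, hi, j, hj, hij⟩ := h A hA hA'
      exact ⟨i, hi, j, hj, not_exch_contract_of_algebra _ hij⟩) hij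
  let S : Set (AlgebraicClosure K) :=
    Set.range (fun p : Σ i, ι i => a p.1 p.2) ∪ Set.range fun p : Σ i, ι i => b p.1 p.2
  have hS : S.Finite := (Set.finite_range _).union (Set.finite_range _)
  have : Finite S := hS
  let L := IntermediateField.adjoin K S
  have hsub : S ⊆ L := IntermediateField.subset_adjoin K S
  let a' : ∀ i, ι i → L := fun i x => ⟨a i x, hsub (Or.inl ⟨⟨i, x⟩, rfl⟩)⟩
  let b' : ∀ i, ι i → L := fun i x => ⟨b i x, hsub (Or.inr ⟨⟨i, x⟩, rfl⟩)⟩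
  refine ⟨L, IntermediateField.finiteDimensional_adjoin fun x _ =>
    (Algebra.IsAlgebraic.isAlgebraic x).isIntegral, a', b', ?_, fun i h0 => hb i ?_⟩
  · have h1 := map_contract L.val T a'
    rw [show contract _ T (fun i x => L.val (a' i x)) = 0 from ha] at h1
    exact L.val.injective (h1.trans (map_zero _).symm)
  · have h1 := map_contract L.val T (Function.update a' i (b' i))
    rw [h0, map_zero] at h1
    rw [h1]
    congr 1
    funext l x
    by_cases hl : l = i
    · subst hl; simp [b']
    · simp [hl, a']

end Generic

/-- A family of ordered partitions of `k * M` points into `k` blocks of size `M` such that blocks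
of different members never fit together to a partition. -/
structure IsUnmixable {k M : ℕ} {J : Type*} (P : J → Fin (k * M) → Fin k) : Prop where
  card_block : ∀ j i, (Finset.univ.filter fun l => P j l = i).card = M
  eq_of_mix : ∀ (j : Fin k → J) (Q : Fin (k * M) → Fin k),
    (∀ i l, Q l = i ↔ P (j i) l = i) → ∀ i i', j i = j i'

/-! ### From unmixable partitions to unit tensors, and descent to the ground field -/

section Descent

variable {K : Type*} [Field K] {k : ℕ} {ι κ : Fin k → Type*} [∀ i, Fintype (ι i)]
  [∀ i, Fintype (κ i)]

theorem IsUnmixable.exists_contract_eq_delta {L : Type*} [Field L] [Algebra K L] (hk : 0 < k)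
    {T : (∀ i, ι i) → K} {a b : ∀ i, ι i → L} (ha : contract L T a = 0)
    (hb : ∀ i, contract L T (Function.update a i (b i)) ≠ 0) {M : ℕ} {J : Type*}
    {P : J → Fin (k * M) → Fin k} (hP : IsUnmixable P) :
    ∃ φ : ∀ i, J → (Fin (k * M) → ι i) → L, ∀ j : Fin k → J,
      contract L (boxPow T (k * M)) (fun i => φ i (j i)) = delta L j := by
  classical
  let ψ : ∀ i, J → (Fin (k * M) → ι i) → L := fun i s x =>
    ∏ l, (if P s l = i then b i else a i) (x l)
  have hψ : ∀ j : Fin k → J, contract L (boxPow T (k * M)) (fun i => ψ i (j i)) =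
      ∏ l, contract L T fun i => if P (j i) l = i then b i else a i := fun j =>
    contract_boxPow T fun l i => if P (j i) l = i then b i else a i
  let c : J → L := fun s => contract L (boxPow T (k * M)) fun i => ψ i s
  have hc : ∀ s, c s ≠ 0 := by
    intro s
    simp only [c]
    rw [hψ fun _ => s]
    refine Finset.prod_ne_zero_iff.2 fun l _ => ?_
    convert! hb (P s l) using 2
    funext i
    by_cases hi : i = P s l
    · subst hi; simp
    · simp [hi, Ne.symm hi]
  let e : Fin k := ⟨0, hk⟩
  -- The diagonal entries `c s` are only nonzero; one direction is rescaled to make them 1.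
  refine ⟨fun i s => (if i = e then (c s)⁻¹ else 1) • ψ i s, fun j => ?_⟩
  rw [MultilinearMap.map_smul_univ, Finset.prod_ite_eq' Finset.univ e, if_pos (Finset.mem_univ _),
    smul_eq_mul]
  by_cases hj : ∀ i i', j i = j i'
  · rw [delta_of_forall hj]
    have : j = fun _ => j e := funext fun i => hj i e
    rw [this]
    exact inv_mul_cancel₀ (hc _)
  · rw [delta_of_not hj, hψ]
    by_contra h0
    have h1 := (mul_ne_zero_iff.1 h0).2
    rw [Finset.prod_ne_zero_iff] at h1
    -- Every position must be covered, since `f a = 0`. The `k` blocks have total size `k * M`, so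
    -- each position is covered exactly once and the blocks form a partition `Q`.
    have h2 : ∀ l, 1 ≤ (Finset.univ.filter fun i => P (j i) l = i).card := by
      intro l
      rw [Finset.one_le_card]
      by_contra h3
      rw [Finset.not_nonempty_iff_eq_empty, Finset.filter_eq_empty_iff] at h3
      refine h1 l (Finset.mem_univ _) ?_
      convert! ha using 2
      funext i
      rw [if_neg (h3 (Finset.mem_univ i))]
    have h3 : ∑ l : Fin (k * M), 1 =
        ∑ l, (Finset.univ.filter fun i => P (j i) l = i).card := by
      simp only [Finset.card_filter]
      rw [Finset.sum_comm]
      simp only [← Finset.card_filter, hP.card_block]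
      simp
    have h4 := (Finset.sum_eq_sum_iff_of_le fun l _ => h2 l).1 h3
    choose Q hQ using fun l => Finset.card_eq_one.1 (h4 l (Finset.mem_univ l)).symm
    refine hj (hP.eq_of_mix j Q fun i l => ?_)
    have h5 : i ∈ Finset.univ.filter (fun i => P (j i) l = i) ↔ i ∈ ({Q l} : Finset (Fin k)) := by
      rw [hQ l]
    rw [Finset.mem_filter, Finset.mem_singleton] at h5
    simp only [Finset.mem_univ, true_and] at h5
    rw [h5, eq_comm]

theorem sum_mul_delta (hk : 0 < k) {J : Type*} [Fintype J] [DecidableEq J]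
    (F : (Fin k → J) → K) : ∑ τ, F τ * delta K τ = ∑ s, F fun _ => s := by
  rw [← Finset.sum_subset (s₁ := Finset.univ.image fun (s : J) (_ : Fin k) => s)
    (Finset.subset_univ _)]
  · rw [Finset.sum_image fun s _ s' _ h => congrFun h ⟨0, hk⟩]
    exact Finset.sum_congr rfl fun s _ => by rw [delta_of_forall fun _ _ => rfl, mul_one]
  · intro τ _ hτ
    rw [delta_of_not, mul_zero]
    exact fun h => hτ (Finset.mem_image.2 ⟨τ ⟨0, hk⟩, Finset.mem_univ _, funext fun i => h _ _⟩)

/-- A diagonalisation over a finite extension `L` of `K` becomes a diagonalisation over `K` in the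
presence of a unit tensor of constant size. -/
theorem diag_boxProd_of_finiteDimensional {L : Type*} [Field L] [Algebra K L]
    [FiniteDimensional K L] (hk : 0 < k) {S : (∀ i, ι i) → K} {S' : (∀ i, κ i) → K} {J : Type*}
    (h : ∃ φ : ∀ i, J → ι i → L, ∀ j : Fin k → J,
      contract L S (fun i => φ i (j i)) = delta L j)
    (h' : Diag S' (Fin k → Fin (Module.finrank K L))) : Diag (boxProd S S') J := by
  classical
  obtain ⟨φ, hφ⟩ := h
  obtain ⟨θ, hθ⟩ := h'
  obtain ⟨g, hg⟩ := LinearMap.exists_leftInverse_of_injective (Algebra.linearMap K L)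
    (LinearMap.ker_eq_bot.2 (algebraMap K L).injective)
  have hg1 : g 1 = 1 := by simpa using LinearMap.congr_fun hg 1
  let ω := Module.finBasis K L
  let e : Fin k := ⟨0, hk⟩
  let α : ∀ i, J → (Fin k → Fin (Module.finrank K L)) → ι i → K := fun i s σ x =>
    ω.repr (φ i s x) (σ i)
  -- Expanding all vectors in the basis `ω` and applying a `K`-linear retraction `g` of `K → L`
  -- writes the diagonal as a sum over `σ` of contractions over `K` with weights `w σ`.
  let w : (Fin k → Fin (Module.finrank K L)) → K := fun σ => g (∏ i, ω (σ i))
  have hsum : ∀ j : Fin k → J, ∑ σ, w σ * contract K S (fun i => α i (j i) σ) = delta K j := by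
    intro j
    have h1 : contract L S (fun i => φ i (j i)) = ∑ σ : Fin k → Fin (Module.finrank K L),
        (∏ i, ω (σ i)) * algebraMap K L (contract K S fun i => α i (j i) σ) := by
      have h2 : (fun i => φ i (j i)) = fun i => ∑ s : Fin (Module.finrank K L),
          ω s • fun x => algebraMap K L (ω.repr (φ i (j i) x) s) := by
        funext i x
        conv_lhs => rw [← ω.sum_repr (φ i (j i) x)]
        simp [Algebra.smul_def, mul_comm]
      rw [h2, MultilinearMap.map_sum]
      refine Finset.sum_congr rfl fun σ _ => ?_
      rw [MultilinearMap.map_smul_univ, smul_eq_mul]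
      congr 1
      exact (map_contract (Algebra.ofId K L) S fun i => α i (j i) σ).symm
    have h3 := congrArg g h1
    rw [hφ, map_sum] at h3
    have h4 : g (delta L j) = delta K j := by
      by_cases hj : ∀ i i', j i = j i'
      · rw [delta_of_forall hj, delta_of_forall hj, hg1]
      · rw [delta_of_not hj, delta_of_not hj, map_zero]
    rw [← h4, h3]
    refine Finset.sum_congr rfl fun σ _ => ?_
    rw [mul_comm (∏ i, ω (σ i)), ← Algebra.smul_def, map_smul, smul_eq_mul, mul_comm]
  -- Each direction sums over its own `σ`; the unit tensor in `S'` forces these choices to agree,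
  -- leaving the single sum `hsum`.
  refine ⟨fun i s => ∑ σ, fun z => ((if i = e then w σ else 1) • α i s σ) z.1 * θ i σ z.2,
    fun j => ?_⟩
  rw [MultilinearMap.map_sum]
  have h1 : ∀ τ : Fin k → Fin k → Fin (Module.finrank K L), contract K (boxProd S S')
      (fun i z => ((if i = e then w (τ i) else 1) • α i (j i) (τ i)) z.1 * θ i (τ i) z.2) =
      (w (τ e) * contract K S fun i => α i (j i) (τ i)) * delta K τ := by
    intro τ
    rw [contract_boxProd S S' (fun i => (if i = e then w (τ i) else 1) • α i (j i) (τ i))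
      (fun i => θ i (τ i)), hθ, MultilinearMap.map_smul_univ, Finset.prod_ite_eq' Finset.univ e,
      if_pos (Finset.mem_univ _), smul_eq_mul]
  rw [Finset.sum_congr rfl fun τ _ => h1 τ,
    sum_mul_delta hk fun τ => w (τ e) * contract K S fun i => α i (j i) (τ i), hsum]

/-- Unmixable families of partitions bound the subranks of powers from below, up to a constant
shift of the exponent. -/
theorem exists_le_subrank_of_isUnmixable (hk : 2 ≤ k) {T : ⨂[K] i, (ι i → K)}
    (h : ∀ A : Finset (Fin k), A.Nonempty → A ≠ Finset.univ →
      ∃ i ∈ A, ∃ j ∉ A, ¬Exch (contract K (toArray T)) {i} {j}) :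
    ∃ m, ∀ (M r : ℕ) (P : Fin r → Fin (k * M) → Fin k), IsUnmixable P →
      r ≤ subrank (kroneckerPow T (k * M + m)) := by
  obtain ⟨L, hL, a, b, ha, hb⟩ := exists_zero_finiteDimensional hk h
  obtain ⟨m₀, hm₀⟩ := exists_diag_two (by lia) h
  obtain ⟨m, hm⟩ := hm₀.exists_of_two (by lia) (Fin k → Fin (Module.finrank K L))
  refine ⟨m, fun M r P hP => le_subrank hk ?_⟩
  rw [toArray_kroneckerPow]
  exact (diag_boxProd_of_finiteDimensional (by lia)
    (hP.exists_contract_eq_delta (by lia) ha hb) hm).boxPow_add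

end Descent

/-! ### Labellings with equal block sums -/

section Kernel

variable {k : ℕ} {X G : Type*} [Fintype X] [DecidableEq X] [AddCommGroup G]

/-- The vector of sums of a labelling `v` over the blocks of the partition `P`. -/
def blockSum (P : X → Fin k) : (X → G) →+ (Fin k → G) where
  toFun v i := ∑ l with P l = i, v l
  map_zero' := by ext; simp
  map_add' v w := by ext; simp [Finset.sum_add_distrib]

omit [DecidableEq X] in
theorem blockSum_apply (P : X → Fin k) (v : X → G) (i : Fin k) :
    blockSum P v i = ∑ l with P l = i, v l := rfl

theorem blockSum_single (P : X → Fin k) (l : X) (g : G) :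
    blockSum P (Pi.single l g) = Pi.single (P l) g := by
  ext i
  rw [blockSum_apply, Finset.sum_pi_single']
  by_cases h : P l = i
  · subst h; simp
  · simp [h, Ne.symm h]

omit [DecidableEq X] in
theorem sum_blockSum (P : X → Fin k) (v : X → G) : ∑ i, blockSum P v i = ∑ l, v l :=
  Finset.sum_fiberwise _ _ _

/-- The labellings on which two partitions have the same block sums. -/
def sameSums (P P' : X → Fin k) : AddSubgroup (X → G) :=
  (blockSum P - blockSum P' : (X → G) →+ (Fin k → G)).ker

omit [DecidableEq X] in
theorem mem_sameSums {P P' : X → Fin k} {v : X → G} :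
    v ∈ sameSums P P' ↔ blockSum P v = blockSum P' v := by
  rw [sameSums, AddMonoidHom.mem_ker, AddMonoidHom.sub_apply, sub_eq_zero]

/-- A retraction `ρ` of the set of block labels that identifies the labels of every point in two
partitions and for which the number of labellings with the same block sums is small. -/
theorem exists_retraction [Finite G] (P P' : X → Fin k) : ∃ ρ : Fin k → Fin k,
    (∀ i, ρ (ρ i) = ρ i) ∧ (∀ l, ρ (P' l) = ρ (P l)) ∧
    (∀ i, (∀ l, P l = i ↔ P' l = i) → ∀ j, ρ j = ρ i → j = i) ∧
    Nat.card (sameSums P P' : AddSubgroup (X → G)) *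
      Nat.card G ^ (Finset.univ.filter fun i => ρ i ≠ i).card ≤
      Nat.card G ^ Fintype.card X := by
  classical
  -- Connected components of the graph on block labels with an edge from `P l` to `P' l` for each
  -- point; `ρ` picks a representative. A shared block is an isolated vertex.
  let s : Setoid (Fin k) := Relation.EqvGen.setoid fun i j => ∃ l, P l = i ∧ P' l = j
  let ρ : Fin k → Fin k := fun i => (Quotient.mk s i).out
  have hρ : ∀ i, s (ρ i) i := fun i => Quotient.mk_out i
  have hρ' : ∀ i j, ρ i = ρ j ↔ s i j := by
    intro i j
    constructor
    · intro h
      exact s.trans (s.symm (hρ i)) (h ▸ hρ j)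
    · intro h
      exact congrArg Quotient.out (Quotient.sound h)
  have hid : ∀ i, ρ (ρ i) = ρ i := fun i => (hρ' _ _).2 (hρ i)
  refine ⟨ρ, hid, fun l => ?_, fun i hi j hj => ?_, ?_⟩
  · exact (hρ' _ _).2 (s.symm (Relation.EqvGen.rel _ _ ⟨l, rfl, rfl⟩))
  · have h1 : Relation.EqvGen (fun i j => ∃ l, P l = i ∧ P' l = j) j i := (hρ' _ _).1 hj
    have h2 : j = i ↔ i = i := by
      generalize hi' : i = i' at h1
      have : ∀ x y, Relation.EqvGen (fun i j => ∃ l, P l = i ∧ P' l = j) x y →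
          (x = i ↔ y = i) := by
        intro x y hxy
        induction hxy with
        | rel x y h =>
          obtain ⟨l, rfl, rfl⟩ := h
          exact hi l
        | refl x => rfl
        | symm x y _ ih => exact ih.symm
        | trans x y z _ _ ih1 ih2 => exact ih1.trans ih2
      subst hi'
      exact this _ _ h1
    exact h2.2 rfl
  · let φ : (X → G) →+ (Fin k → G) := blockSum P - blockSum P'
    have hmem : ∀ i j, Relation.EqvGen (fun i j => ∃ l, P l = i ∧ P' l = j) i j → ∀ g : G,
        (Pi.single i g - Pi.single j g : Fin k → G) ∈ φ.range := by
      intro i j hij g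
      induction hij with
      | rel x y h =>
        obtain ⟨l, rfl, rfl⟩ := h
        refine ⟨Pi.single l g, ?_⟩
        rw [AddMonoidHom.sub_apply, blockSum_single, blockSum_single]
      | refl x => simp
      | symm x y _ ih => simpa using neg_mem ih
      | trans x y z _ _ ih1 ih2 => simpa using add_mem ih1 ih2
    -- Differences along a component lie in the range of `φ`, so each non-representative contributes
    -- a factor `|G|` to the range, which bounds the kernel.
    let E := {i : Fin k // ρ i ≠ i}
    let u : (E → G) → φ.range := fun w =>
      ⟨∑ i : E, (Pi.single i.1 (w i) - Pi.single (ρ i.1) (w i)),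
        sum_mem fun i _ => hmem _ _ (s.symm (hρ i.1)) _⟩
    have hu : Function.Injective u := by
      have hval : ∀ (w : E → G) (i : E), (u w).1 i.1 = w i := by
        intro w i
        simp only [u, Finset.sum_apply, Pi.sub_apply]
        rw [Finset.sum_eq_single i]
        · simp [Ne.symm i.2]
        · intro j _ hj
          have h1 : i.1 ≠ j.1 := fun h => hj (Subtype.ext h.symm)
          have h2 : i.1 ≠ ρ j.1 := fun h => i.2 (by rw [h, hid])
          simp [h1, h2]
        · simp
      intro w w' h
      funext i
      rw [← hval w, ← hval w', h]
    have h1 := Nat.card_le_card_of_injective u hu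
    rw [Nat.card_fun, Nat.card_eq_fintype_card (α := E), Fintype.card_subtype] at h1
    have h2 := AddSubgroup.card_eq_card_quotient_mul_card_addSubgroup (φ.ker)
    rw [Nat.card_congr (QuotientAddGroup.quotientKerEquivRange φ).toEquiv, Nat.card_fun,
      Nat.card_eq_fintype_card (α := X)] at h2
    rw [h2, mul_comm]
    exact Nat.mul_le_mul_right _ h1

end Kernel

/-! ### Counting relabellings along a retraction -/

section Retraction

variable {k : ℕ}

/-- The number of ways to relabel along a retraction with bounded fibres. -/
theorem prod_fiber_pow_le {ρ : Fin k → Fin k} (hid : ∀ i, ρ (ρ i) = ρ i) (hne : ∃ i, ρ i ≠ i)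
    (hsing : ∃ i, ∀ j, ρ j = ρ i → j = i) {C g M : ℕ}
    (hC : ∀ m, 1 ≤ m → m < k → C ^ (m - 1) * m ^ (m * M) ≤ g ^ (m - 1)) :
    C * ∏ i, (Finset.univ.filter fun j => ρ j = ρ i).card ^ M ≤
      g ^ (Finset.univ.filter fun i => ρ i ≠ i).card := by
  classical
  let m : Fin k → ℕ := fun r => (Finset.univ.filter fun j => ρ j = r).card
  have hprod : ∏ i, (Finset.univ.filter fun j => ρ j = ρ i).card ^ M = ∏ r, m r ^ (m r * M) := by
    rw [← Finset.prod_fiberwise Finset.univ ρ]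
    refine Finset.prod_congr rfl fun r _ => ?_
    rw [mul_comm, pow_mul, ← Finset.prod_const]
    exact Finset.prod_congr rfl fun i hi => by rw [(Finset.mem_filter.1 hi).2]
  have hnr : (Finset.univ.filter fun i => ρ i ≠ i).card = ∑ r, (m r - 1) := by
    rw [Finset.card_eq_sum_card_fiberwise (f := ρ) (t := Finset.univ) fun _ _ => by simp]
    refine Finset.sum_congr rfl fun r _ => ?_
    have h1 : (Finset.univ.filter fun i => ρ i ≠ i).filter (fun i => ρ i = r) =
        (Finset.univ.filter fun j => ρ j = r).erase r := by
      ext i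
      simp only [Finset.mem_filter, Finset.mem_univ, true_and, Finset.mem_erase]
      constructor
      · rintro ⟨h1, rfl⟩
        exact ⟨Ne.symm h1, rfl⟩
      · rintro ⟨h1, rfl⟩
        exact ⟨Ne.symm h1, rfl⟩
    rw [h1]
    by_cases hr : ρ r = r
    · rw [Finset.card_erase_of_mem (by simp [hr])]
    · have h2 : (Finset.univ.filter fun j => ρ j = r) = ∅ := by
        rw [Finset.filter_eq_empty_iff]
        rintro j _ rfl
        exact hr (hid j)
      simp [m, h2]
  obtain ⟨i₀, hi₀⟩ := hsing
  have hm : ∀ r, C ^ (m r - 1) * m r ^ (m r * M) ≤ g ^ (m r - 1) := by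
    intro r
    rcases Nat.eq_zero_or_pos (m r) with h0 | h0
    · simp [h0]
    rcases Nat.lt_or_ge (m r) k with h1 | h1
    · exact hC _ h0 h1
    -- A fibre of size `k` would make `ρ` constant; the singleton fibre then leaves only one label,
    -- against `hne`.
    · have h2 : Finset.univ.filter (fun j => ρ j = r) = Finset.univ := by
        rw [← Finset.card_eq_iff_eq_univ, Fintype.card_fin]
        exact le_antisymm (by simpa using Finset.card_le_univ (α := Fin k) _) h1
      have h3 : ∀ j, ρ j = r := fun j => by
        have : j ∈ Finset.univ.filter (fun j => ρ j = r) := by rw [h2]; simp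
        exact (Finset.mem_filter.1 this).2
      obtain ⟨i, hi⟩ := hne
      have h4 : ∀ j, j = i₀ := fun j => hi₀ j (by rw [h3, h3])
      exact absurd ((h4 _).trans (h4 _).symm) hi
  rw [hprod, hnr, ← Finset.prod_pow_eq_pow_sum]
  refine le_trans ?_ (Finset.prod_le_prod' fun r _ => hm r)
  rw [Finset.prod_mul_distrib, Finset.prod_pow_eq_pow_sum, ← hnr]
  refine Nat.mul_le_mul_right _ (Nat.le_self_pow ?_ C)
  obtain ⟨i, hi⟩ := hne
  exact (Finset.card_pos.2 ⟨i, by simpa using hi⟩).ne'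

theorem card_relabel {X : Type*} [Fintype X] [DecidableEq X] {P : X → Fin k} {M : ℕ}
    (hP : ∀ i, (Finset.univ.filter fun l => P l = i).card = M) (ρ : Fin k → Fin k) :
    (Finset.univ.filter fun P' : X → Fin k => ∀ l, ρ (P' l) = ρ (P l)).card =
      ∏ i, (Finset.univ.filter fun j => ρ j = ρ i).card ^ M := by
  have h1 : (Finset.univ.filter fun P' : X → Fin k => ∀ l, ρ (P' l) = ρ (P l)) =
      Fintype.piFinset fun l => Finset.univ.filter fun j => ρ j = ρ (P l) := by
    ext P'
    simp [Fintype.mem_piFinset]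
  rw [h1, Fintype.card_piFinset, ← Finset.prod_fiberwise Finset.univ P]
  refine Finset.prod_congr rfl fun i _ => ?_
  rw [← hP i, ← Finset.prod_const]
  exact Finset.prod_congr rfl fun l hl => by rw [(Finset.mem_filter.1 hl).2]

end Retraction

/-! ### Strassen's hashing argument -/

section Hashing

variable {κ M : ℕ} {G : Type*} [AddCommGroup G] [Fintype G]

/-- The hash of the partition `P` takes the value `b`. -/
def Hits {X : Type*} [Fintype X] (ω : (Fin κ → G) × (X → G)) (b : G) (P : X → Fin (κ + 1)) :
    Prop :=
  ∀ i : Fin κ, ω.1 i + blockSum P ω.2 i.castSucc = b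

/-- Two different partitions that share a block. -/
def Collide {X : Type*} (P P' : X → Fin (κ + 1)) : Prop :=
  P ≠ P' ∧ ∃ i, ∀ l, P l = i ↔ P' l = i

omit [Fintype G] in
theorem Hits.eq {X : Type*} [Fintype X] (hκ : 1 ≤ κ) {ω : (Fin κ → G) × (X → G)} {b b' : G}
    {P : X → Fin (κ + 1)} (h : Hits ω b P) (h' : Hits ω b' P) : b = b' := by
  rw [← h ⟨0, hκ⟩, ← h' ⟨0, hκ⟩]

open Classical in
theorem card_hits {X : Type*} [Fintype X] (b : G) (P : X → Fin (κ + 1)) :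
    (Finset.univ.filter fun ω : (Fin κ → G) × (X → G) => Hits ω b P).card =
      Fintype.card G ^ Fintype.card X := by
  rw [← Fintype.card_fun, ← Finset.card_univ]
  refine Finset.card_nbij' (fun ω => ω.2)
    (fun v => (fun i => b - blockSum P v i.castSucc, v)) ?_ ?_ ?_ ?_
  · exact fun _ _ => Finset.mem_coe.2 (Finset.mem_univ _)
  · exact fun v _ => Finset.mem_coe.2 (Finset.mem_filter.2
      ⟨Finset.mem_univ _, fun i => sub_add_cancel _ _⟩)
  · intro ω hω
    have : Hits ω b P := by simpa using hω
    refine Prod.ext (funext fun i => ?_) rfl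
    simp only
    rw [← this i, add_sub_cancel_right]
  · exact fun _ _ => rfl

-- Two hits of the same value equate the first `κ` block sums, and the total sum of the labels then
-- equates the last ones. The offsets `ω.1` are determined by the labels.
open Classical in
theorem card_hits_and_le {X : Type*} [Fintype X] (b : G) (P P' : X → Fin (κ + 1)) :
    (Finset.univ.filter fun ω : (Fin κ → G) × (X → G) => Hits ω b P ∧ Hits ω b P').card ≤
      Nat.card (sameSums P P' : AddSubgroup (X → G)) := by
  rw [← Fintype.card_coe, ← Nat.card_eq_fintype_card]
  refine Nat.card_le_card_of_injective (fun ω => ⟨ω.1.2, ?_⟩) ?_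
  · obtain ⟨h1, h2⟩ := (Finset.mem_filter.1 ω.2).2
    rw [mem_sameSums]
    have h3 : ∀ i : Fin κ, blockSum P ω.1.2 i.castSucc = blockSum P' ω.1.2 i.castSucc :=
      fun i => add_left_cancel ((h1 i).trans (h2 i).symm)
    funext i
    refine Fin.lastCases ?_ h3 i
    have h4 := (sum_blockSum P ω.1.2).trans (sum_blockSum P' ω.1.2).symm
    rw [Fin.sum_univ_castSucc, Fin.sum_univ_castSucc, Finset.sum_congr rfl fun i _ => h3 i] at h4
    exact add_left_cancel h4
  · intro ω ω' h
    have h1 : ω.1.2 = ω'.1.2 := congrArg Subtype.val h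
    refine Subtype.ext (Prod.ext (funext fun i => ?_) h1)
    have h2 := (Finset.mem_filter.1 ω.2).2.1 i
    have h3 := (Finset.mem_filter.1 ω'.2).2.1 i
    rw [← h1] at h3
    exact add_right_cancel (h2.trans h3.symm)

open Classical in
/-- The partitions of `X` into labelled blocks of size `M`. -/
noncomputable def balanced (k M : ℕ) (X : Type*) [Fintype X] : Finset (X → Fin k) :=
  Finset.univ.filter fun P => ∀ i, (Finset.univ.filter fun l => P l = i).card = M

theorem mem_balanced {k M : ℕ} {X : Type*} [Fintype X] {P : X → Fin k} :
    P ∈ balanced k M X ↔ ∀ i, (Finset.univ.filter fun l => P l = i).card = M := by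
  simp [balanced]

open Classical in
/-- The expected number of collisions is small. -/
theorem sum_card_sameSums_le {X : Type*} [Fintype X]
    (hG : ∀ m, 1 ≤ m → m < κ + 1 →
      (2 * (κ + 1) ^ (κ + 1)) ^ (m - 1) * m ^ (m * M) ≤ Fintype.card G ^ (m - 1))
    {P : X → Fin (κ + 1)} (hP : P ∈ balanced (κ + 1) M X) :
    2 * ∑ P' ∈ (balanced (κ + 1) M X).filter (Collide P),
      Nat.card (sameSums P P' : AddSubgroup (X → G)) ≤ Fintype.card G ^ Fintype.card X := by
  choose g hid hrel hsing hcard using fun P' : X → Fin (κ + 1) =>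
    exists_retraction (G := G) P P'
  have hcG : 0 < Fintype.card G := Fintype.card_pos
  set S := (balanced (κ + 1) M X).filter (Collide P) with hS
  -- Colliding partitions are grouped by their retraction. There are at most `(κ + 1) ^ (κ + 1)`
  -- groups, which explains the constant in `hG`; its 2 keeps the expected collisions below half the
  -- hits.
  have key : ∀ ρ : Fin (κ + 1) → Fin (κ + 1), 2 * (κ + 1) ^ (κ + 1) *
      ∑ P' ∈ S with g P' = ρ, Nat.card (sameSums P P' : AddSubgroup (X → G)) ≤
        Fintype.card G ^ Fintype.card X := by
    intro ρ
    rcases Finset.eq_empty_or_nonempty (S.filter fun P' => g P' = ρ) with h0 | ⟨P₁, hP₁⟩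
    · rw [h0]; simp
    obtain ⟨hP₁S, rfl⟩ := Finset.mem_filter.1 hP₁
    obtain ⟨hne, i₀, hi₀⟩ := (Finset.mem_filter.1 hP₁S).2
    have h1 := prod_fiber_pow_le (hid P₁)
      (by
        by_contra! h
        refine hne (funext fun l => ?_)
        have := hrel P₁ l
        rw [h, h] at this
        exact this.symm)
      ⟨i₀, hsing P₁ i₀ hi₀⟩ hG
    rw [← card_relabel (mem_balanced.1 hP) (g P₁)] at h1
    set e := (Finset.univ.filter fun i => g P₁ i ≠ i).card with he
    refine Nat.le_of_mul_le_mul_right ?_ (pow_pos hcG e)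
    have h2 : (∑ P' ∈ S with g P' = g P₁, Nat.card (sameSums P P' : AddSubgroup (X → G))) *
        Fintype.card G ^ e ≤ (Finset.univ.filter fun P' : X → Fin (κ + 1) =>
          ∀ l, g P₁ (P' l) = g P₁ (P l)).card * Fintype.card G ^ Fintype.card X := by
      rw [Finset.sum_mul]
      refine (Finset.sum_le_card_nsmul _ _ (Fintype.card G ^ Fintype.card X) ?_).trans ?_
      · intro P' hP'
        have h3 := hcard P'
        rw [(Finset.mem_filter.1 hP').2, Nat.card_eq_fintype_card (α := G)] at h3
        exact h3
      · rw [smul_eq_mul]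
        refine Nat.mul_le_mul_right _ (Finset.card_le_card fun P' hP' => ?_)
        rw [Finset.mem_filter]
        refine ⟨Finset.mem_univ _, fun l => ?_⟩
        have h3 := hrel P' l
        rw [(Finset.mem_filter.1 hP').2] at h3
        exact h3
    calc _ = 2 * (κ + 1) ^ (κ + 1) * ((∑ P' ∈ S with g P' = g P₁,
          Nat.card (sameSums P P' : AddSubgroup (X → G))) * Fintype.card G ^ e) := by ring
      _ ≤ 2 * (κ + 1) ^ (κ + 1) * ((Finset.univ.filter fun P' : X → Fin (κ + 1) =>
          ∀ l, g P₁ (P' l) = g P₁ (P l)).card * Fintype.card G ^ Fintype.card X) :=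
        Nat.mul_le_mul_left _ h2
      _ = (2 * (κ + 1) ^ (κ + 1) * (Finset.univ.filter fun P' : X → Fin (κ + 1) =>
          ∀ l, g P₁ (P' l) = g P₁ (P l)).card) * Fintype.card G ^ Fintype.card X := by ring
      _ ≤ Fintype.card G ^ e * Fintype.card G ^ Fintype.card X := Nat.mul_le_mul_right _ h1
      _ = _ := mul_comm _ _
  have h1 := Finset.sum_le_sum fun ρ (_ : ρ ∈ (Finset.univ : Finset (Fin (κ + 1) → Fin (κ + 1)))) =>
    key ρ
  rw [← Finset.mul_sum, Finset.sum_fiberwise, Finset.sum_const, Finset.card_univ,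
    Fintype.card_fun, Fintype.card_fin, smul_eq_mul] at h1
  have hpos : 0 < (κ + 1) ^ (κ + 1) := by positivity
  refine Nat.le_of_mul_le_mul_left ?_ hpos
  refine le_trans (le_of_eq ?_) h1
  ring

open Classical in
/-- A hash with few collisions exists. -/
theorem exists_hash {X : Type*} [Fintype X] (B : Finset G)
    (hG : ∀ m, 1 ≤ m → m < κ + 1 →
      (2 * (κ + 1) ^ (κ + 1)) ^ (m - 1) * m ^ (m * M) ≤ Fintype.card G ^ (m - 1)) :
    ∃ ω : (Fin κ → G) × (X → G), (balanced (κ + 1) M X).card * B.card +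
      2 * Fintype.card G ^ κ * ∑ b ∈ B, ∑ P ∈ balanced (κ + 1) M X,
        ((balanced (κ + 1) M X).filter fun P' => Collide P P' ∧ Hits ω b P ∧ Hits ω b P').card ≤
      2 * Fintype.card G ^ κ * ∑ b ∈ B, ((balanced (κ + 1) M X).filter (Hits ω b)).card := by
  set Φ := balanced (κ + 1) M X with hΦ
  set gN := Fintype.card G ^ Fintype.card X with hgN
  have hpos : 0 < Fintype.card G := Fintype.card_pos
  have hA : ∑ ω : (Fin κ → G) × (X → G), ∑ b ∈ B, (Φ.filter (Hits ω b)).card =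
      B.card * (Φ.card * gN) := by
    rw [Finset.sum_comm, Finset.sum_const_nat]
    intro b _
    simp only [Finset.card_filter]
    rw [Finset.sum_comm, Finset.sum_const_nat]
    intro P _
    rw [← Finset.card_filter, card_hits]
  have hBad : 2 * ∑ ω : (Fin κ → G) × (X → G), ∑ b ∈ B, ∑ P ∈ Φ,
      (Φ.filter fun P' => Collide P P' ∧ Hits ω b P ∧ Hits ω b P').card ≤
        B.card * (Φ.card * gN) := by
    rw [Finset.sum_comm, Finset.mul_sum, ← smul_eq_mul B.card]
    refine Finset.sum_le_card_nsmul _ _ _ fun b _ => ?_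
    rw [Finset.sum_comm, Finset.mul_sum, ← smul_eq_mul Φ.card]
    refine Finset.sum_le_card_nsmul _ _ _ fun P hP => ?_
    refine le_trans (Nat.mul_le_mul_left 2 ?_) (sum_card_sameSums_le (G := G) hG hP)
    have hff : ∀ ω : (Fin κ → G) × (X → G),
        (Φ.filter fun P' => Collide P P' ∧ Hits ω b P ∧ Hits ω b P').card =
          ∑ P' ∈ Φ.filter (Collide P), if Hits ω b P ∧ Hits ω b P' then 1 else 0 := by
      intro ω
      rw [← Finset.card_filter, Finset.filter_filter]
    rw [Finset.sum_congr rfl fun ω _ => hff ω, Finset.sum_comm]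
    refine Finset.sum_le_sum fun P' _ => ?_
    rw [← Finset.card_filter]
    exact card_hits_and_le b P P'
  by_contra! h
  have h1 := Finset.sum_lt_sum_of_nonempty (s := (Finset.univ : Finset ((Fin κ → G) × (X → G))))
    Finset.univ_nonempty fun ω _ => h ω
  simp only [Finset.sum_add_distrib, ← Finset.mul_sum] at h1
  rw [hA, Finset.sum_const,
    Finset.card_univ, Fintype.card_prod, Fintype.card_fun, Fintype.card_fun, Fintype.card_fin,
    smul_eq_mul, ← hgN] at h1
  have h2 := Nat.mul_le_mul_left (Fintype.card G ^ κ) hBad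
  nlinarith

/-- Hashing produces large unmixable families of partitions. -/
theorem exists_isUnmixable (hκ : 1 ≤ κ) (B : Finset G)
    (hB : ∀ b : Fin (κ + 1) → G, (∀ i, b i ∈ B) →
      ∑ i : Fin κ, b i.castSucc = κ • b (Fin.last κ) → ∀ i i', b i = b i')
    (hG : ∀ m, 1 ≤ m → m < κ + 1 →
      (2 * (κ + 1) ^ (κ + 1)) ^ (m - 1) * m ^ (m * M) ≤ Fintype.card G ^ (m - 1)) :
    ∃ (r : ℕ) (P : Fin r → Fin ((κ + 1) * M) → Fin (κ + 1)), IsUnmixable P ∧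
      (balanced (κ + 1) M (Fin ((κ + 1) * M))).card * B.card ≤
        2 * Fintype.card G ^ κ * r := by
  classical
  obtain ⟨ω, hω⟩ := exists_hash (X := Fin ((κ + 1) * M)) (M := M) B hG
  set Φ := balanced (κ + 1) M (Fin ((κ + 1) * M)) with hΦ
  -- The partitions that hit `B` without a collision at the same value. At most one partition is
  -- discarded per ordered colliding pair.
  let F : Finset (Fin ((κ + 1) * M) → Fin (κ + 1)) :=
    Φ.filter fun P => ∃ b ∈ B, Hits ω b P ∧ ∀ P' ∈ Φ, Collide P P' → ¬Hits ω b P'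
  have hF : ∑ b ∈ B, (Φ.filter (Hits ω b)).card ≤ ∑ b ∈ B, ∑ P ∈ Φ,
      (Φ.filter fun P' => Collide P P' ∧ Hits ω b P ∧ Hits ω b P').card + F.card := by
    have h1 : F.card = ∑ b ∈ B, (Φ.filter fun P =>
        Hits ω b P ∧ ∀ P' ∈ Φ, Collide P P' → ¬Hits ω b P').card := by
      rw [← Finset.card_biUnion]
      · congr 1
        ext P
        simp only [F, Finset.mem_filter, Finset.mem_biUnion]
        tauto
      · intro b _ b' _ hbb'
        rw [Function.onFun, Finset.disjoint_left]
        intro P hP hP'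
        exact hbb' ((Finset.mem_filter.1 hP).2.1.eq hκ (Finset.mem_filter.1 hP').2.1)
    rw [h1, ← Finset.sum_add_distrib]
    refine Finset.sum_le_sum fun b _ => ?_
    rw [Finset.card_filter, Finset.card_filter, ← Finset.sum_add_distrib]
    refine Finset.sum_le_sum fun P hP => ?_
    split_ifs with h2 h3
    · lia
    · have h4 : ∃ P' ∈ Φ, Collide P P' ∧ Hits ω b P' := by
        by_contra! h5
        exact h3 ⟨h2, h5⟩
      obtain ⟨P', hP', h5, h6⟩ := h4
      rw [add_zero, Finset.one_le_card]
      exact ⟨P', Finset.mem_filter.2 ⟨hP', h5, h2, h6⟩⟩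
    · lia
    · lia
  refine ⟨F.card, fun j => (F.equivFin.symm j).1, ⟨fun j i => ?_, fun j Q hQ => ?_⟩, ?_⟩
  · have := (Finset.mem_filter.1 (F.equivFin.symm j).2).1
    exact mem_balanced.1 this i
  · have h1 : ∀ i, ∃ b ∈ B, Hits ω b (F.equivFin.symm (j i)).1 ∧
        ∀ P' ∈ Φ, Collide (F.equivFin.symm (j i)).1 P' → ¬Hits ω b P' :=
      fun i => (Finset.mem_filter.1 (F.equivFin.symm (j i)).2).2
    choose b hbB hbhit hbcol using h1
    have h2 : ∀ i, blockSum (F.equivFin.symm (j i)).1 ω.2 i = blockSum Q ω.2 i := by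
      intro i
      rw [blockSum_apply, blockSum_apply]
      congr 1
      ext l
      simp [hQ i l]
    have h3 : ∀ i : Fin κ, ω.1 i + blockSum Q ω.2 i.castSucc = b i.castSucc := by
      intro i
      rw [← h2]
      exact hbhit i.castSucc i
    -- The last block carries no hash condition. Its sum is that of the member taken in the last
    -- direction, whose `κ` conditions and the total label sum supply the relation. Comparison with
    -- `Q` gives an average in `B`.
    have h4 : ∑ i, ω.1 i + ∑ l, ω.2 l = κ • b (Fin.last κ) + blockSum Q ω.2 (Fin.last κ) := by
      rw [← h2, ← sum_blockSum (F.equivFin.symm (j (Fin.last κ))).1 ω.2, Fin.sum_univ_castSucc,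
        ← add_assoc, ← Finset.sum_add_distrib,
        Finset.sum_congr rfl fun i _ => hbhit (Fin.last κ) i]
      simp
    have h5 : ∑ i : Fin κ, b i.castSucc = κ • b (Fin.last κ) := by
      rw [← sum_blockSum Q ω.2, Fin.sum_univ_castSucc, ← add_assoc,
        ← Finset.sum_add_distrib, Finset.sum_congr rfl fun i _ => h3 i] at h4
      exact add_right_cancel h4
    have h6 := hB b hbB h5
    have hQΦ : Q ∈ Φ := by
      refine mem_balanced.2 fun i => ?_
      have h7 := (Finset.mem_filter.1 (F.equivFin.symm (j i)).2).1
      refine Eq.trans ?_ (mem_balanced.1 h7 i)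
      congr 1
      ext l
      simp [hQ i l]
    have h8 : ∀ i, (F.equivFin.symm (j i)).1 = Q := by
      intro i
      by_contra h9
      refine hbcol i Q hQΦ ⟨h9, i, fun l => (hQ i l).symm⟩ fun i' => ?_
      rw [h3, h6]
    intro i i'
    exact F.equivFin.symm.injective (Subtype.ext ((h8 i).trans (h8 i').symm))
  · have := Nat.mul_le_mul_left (2 * Fintype.card G ^ κ) hF
    rw [mul_add] at this
    lia

end Hashing

/-! ### Counting balanced partitions -/

section Count

theorem factorial_pow_mul_le (k M : ℕ) :
    (M + 1).factorial ^ k * k ^ (k * M) ≤ (k * (M + 1)).factorial * (M + 1) ^ k := by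
  induction M with
  | zero => simpa using Nat.one_le_iff_ne_zero.2 (Nat.factorial_pos k).ne'
  | succ M ih =>
    calc (M + 1 + 1).factorial ^ k * k ^ (k * (M + 1))
        = (M + 1 + 1) ^ k * k ^ k * ((M + 1).factorial ^ k * k ^ (k * M)) := by
          rw [Nat.factorial_succ (M + 1), mul_pow, mul_add k M 1, mul_one, pow_add]
          ring
      _ ≤ (M + 1 + 1) ^ k * k ^ k * ((k * (M + 1)).factorial * (M + 1) ^ k) :=
          Nat.mul_le_mul_left _ ih
      _ = (M + 1 + 1) ^ k * ((k * (M + 1)).factorial * (k * (M + 1)) ^ k) := by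
          rw [mul_pow k]
          ring
      _ ≤ (M + 1 + 1) ^ k * (k * (M + 1) + k).factorial := by
          refine Nat.mul_le_mul_left _ (le_trans (Nat.mul_le_mul_left _ ?_)
            Nat.factorial_mul_pow_le_factorial)
          exact Nat.pow_le_pow_left (Nat.le_succ _) _
      _ = _ := by
          rw [mul_add k (M + 1) 1, mul_one, mul_comm]

/-- Permutations act on balanced partitions, and each fibre of `σ ↦ P₀ ∘ σ` is empty or injects into
the stabiliser of `P₀`, of order `M.factorial ^ k`. -/
theorem factorial_le_card_balanced (k M : ℕ) :
    (k * M).factorial ≤ (balanced k M (Fin (k * M))).card * M.factorial ^ k := by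
  classical
  let P₀ : Fin (k * M) → Fin k := fun l => (finProdFinEquiv.symm l).1
  have hP₀ : ∀ i, (Finset.univ.filter fun l => P₀ l = i).card = M := by
    intro i
    have : (Finset.univ.filter fun l => P₀ l = i) =
        (Finset.univ : Finset (Fin M)).map ⟨fun x => finProdFinEquiv (i, x),
          fun x y h => by simpa using h⟩ := by
      ext l
      simp only [Finset.mem_filter, Finset.mem_univ, true_and, Finset.mem_map, P₀]
      constructor
      · rintro rfl
        exact ⟨(finProdFinEquiv.symm l).2, finProdFinEquiv.apply_symm_apply l⟩
      · rintro ⟨x, rfl⟩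
        exact congrArg Prod.fst (finProdFinEquiv.symm_apply_apply (i, x))
    rw [this, Finset.card_map, Finset.card_univ, Fintype.card_fin]
  have hmaps : ∀ σ ∈ (Finset.univ : Finset (Equiv.Perm (Fin (k * M)))),
      P₀ ∘ σ ∈ balanced k M (Fin (k * M)) := by
    intro σ _
    refine mem_balanced.2 fun i => (Eq.trans ?_ (hP₀ i) :)
    refine Finset.card_bij (fun l _ => σ l) ?_ (fun _ _ _ _ h => σ.injective h) ?_
    · intro l hl
      simpa using hl
    · intro l hl
      exact ⟨σ.symm l, by simpa using hl, by simp⟩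
  have h1 := Finset.card_le_mul_card_image_of_maps_to hmaps (M.factorial ^ k) ?_
  · rwa [Finset.card_univ, Fintype.card_perm, Fintype.card_fin, mul_comm (M.factorial ^ k)] at h1
  · intro P _
    rcases Finset.eq_empty_or_nonempty
      (Finset.univ.filter fun σ : Equiv.Perm (Fin (k * M)) => P₀ ∘ σ = P) with h0 | ⟨σ₀, hσ₀⟩
    · rw [h0]
      simp
    · have h2 : Fintype.card {g : Equiv.Perm (Fin (k * M)) // P₀ ∘ g = P₀} = M.factorial ^ k := by
        rw [DomMulAct.stabilizer_card]
        simp [Fintype.card_subtype, hP₀]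
      rw [← h2, Fintype.card_subtype]
      refine Finset.card_le_card_of_injOn (fun σ => σ * σ₀⁻¹) ?_ ?_
      · intro σ hσ
        have h3 : P₀ ∘ σ = P := by simpa using hσ
        have h4 : P₀ ∘ σ₀ = P := by simpa using hσ₀
        simp only [Finset.coe_filter, Finset.mem_univ, true_and, Set.mem_ofPred_eq]
        rw [Equiv.Perm.coe_mul, ← Function.comp_assoc, h3, ← h4]
        funext l
        simp
      · intro σ _ σ' _ h
        exact mul_right_cancel h

theorem pow_le_card_balanced (k : ℕ) {M : ℕ} (hM : 1 ≤ M) :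
    k ^ (k * M) ≤ k ^ k * M ^ k * (balanced k M (Fin (k * M))).card := by
  obtain ⟨M, rfl⟩ := Nat.exists_eq_add_of_le' hM
  have h1 := (factorial_pow_mul_le k M).trans
    (Nat.mul_le_mul_right _ (factorial_le_card_balanced k (M + 1)))
  have h2 : 0 < (M + 1).factorial ^ k := pow_pos (Nat.factorial_pos _) _
  refine Nat.le_of_mul_le_mul_left ?_ h2
  have h3 := Nat.mul_le_mul_left (k ^ k) h1
  calc _ = k ^ k * ((M + 1).factorial ^ k * k ^ (k * M)) := by
        rw [mul_add k M 1, mul_one, pow_add]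
        ring
    _ ≤ _ := h3
    _ = _ := by ring

end Count

/-! ### Behrend's construction -/

section Sphere

/-- Strict convexity of the sphere: the squared distances from `y` to the `x i` add up to `2κs - 2κs
= 0`. -/
theorem eq_of_sum_eq_of_sum_sq_eq {κ D : ℕ} {x : Fin κ → Fin D → ℤ} {y : Fin D → ℤ} {s : ℤ}
    (hsum : ∀ t, ∑ i, x i t = κ * y t) (hx : ∀ i, ∑ t, x i t ^ 2 = s) (hy : ∑ t, y t ^ 2 = s)
    (i : Fin κ) : x i = y := by
  have h1 : ∑ i, ∑ t, (x i t - y t) ^ 2 = 0 := by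
    have h2 : ∀ i, ∑ t, (x i t - y t) ^ 2 = 2 * s - 2 * ∑ t, x i t * y t := by
      intro i
      have h3 : ∑ t, (x i t - y t) ^ 2 = ∑ t, x i t ^ 2 + ∑ t, y t ^ 2 - 2 * ∑ t, x i t * y t := by
        rw [Finset.mul_sum, ← Finset.sum_add_distrib, ← Finset.sum_sub_distrib]
        exact Finset.sum_congr rfl fun t _ => by ring
      rw [h3, hx, hy]
      ring
    have h4 : ∑ i, ∑ t, x i t * y t = κ * s := by
      rw [Finset.sum_comm, ← hy, Finset.mul_sum]
      refine Finset.sum_congr rfl fun t _ => ?_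
      rw [← Finset.sum_mul, hsum]
      ring
    rw [Finset.sum_congr rfl fun i _ => h2 i, Finset.sum_sub_distrib, ← Finset.mul_sum,
      ← Finset.mul_sum, h4]
    simp
  funext t
  have h2 := (Finset.sum_eq_zero_iff_of_nonneg fun i _ =>
    Finset.sum_nonneg fun t _ => sq_nonneg _).1 h1 i (Finset.mem_univ i)
  have h3 := (Finset.sum_eq_zero_iff_of_nonneg fun t _ => sq_nonneg _).1 h2 t (Finset.mem_univ t)
  exact sub_eq_zero.1 (pow_eq_zero_iff two_ne_zero |>.1 h3)

/-- A dense set without nontrivial averages, after Behrend. -/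
theorem exists_average_free {κ D d q : ℕ} (hD : 1 ≤ D) (hd : 1 ≤ d) (hκ : 1 ≤ κ)
    (hq : κ * d < q) : ∃ B : Finset (Fin D → ZMod q), d ^ D ≤ D * d ^ 2 * B.card ∧
      ∀ b : Fin (κ + 1) → Fin D → ZMod q, (∀ i, b i ∈ B) →
        ∑ i : Fin κ, b i.castSucc = κ • b (Fin.last κ) → ∀ i i', b i = b i' := by
  classical
  let nrm : (Fin D → Fin d) → ℕ := fun x => ∑ t, (x t : ℕ) ^ 2
  have hmaps : ∀ x ∈ (Finset.univ : Finset (Fin D → Fin d)),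
      nrm x ∈ Finset.range (D * d ^ 2) := by
    intro x _
    rw [Finset.mem_range]
    have : ∑ _t : Fin D, d ^ 2 = D * d ^ 2 := by simp
    rw [← this]
    refine Finset.sum_lt_sum_of_nonempty ⟨⟨0, hD⟩, Finset.mem_univ _⟩ fun t _ => ?_
    exact Nat.pow_lt_pow_left (x t).2 two_ne_zero
  have hne : (Finset.range (D * d ^ 2)).Nonempty := by
    rw [Finset.nonempty_range_iff]
    positivity
  obtain ⟨s, hs, hcard⟩ : ∃ s ∈ Finset.range (D * d ^ 2), d ^ D ≤
      D * d ^ 2 * (Finset.univ.filter fun x => nrm x = s).card := by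
    by_contra! h
    have h1 := Finset.sum_lt_sum_of_nonempty hne h
    rw [← Finset.mul_sum, ← Finset.card_eq_sum_card_fiberwise hmaps, Finset.card_univ,
      Fintype.card_fun, Fintype.card_fin, Fintype.card_fin, Finset.sum_const, Finset.card_range,
      smul_eq_mul] at h1
    exact lt_irrefl _ h1
  let emb : (Fin D → Fin d) → Fin D → ZMod q := fun x t => ((x t : ℕ) : ZMod q)
  have hdq : d < q := lt_of_le_of_lt (Nat.le_mul_of_pos_left d hκ) hq
  have hcast : ∀ a b : ℕ, a < q → b < q → (a : ZMod q) = b → a = b := by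
    intro a b ha hb h
    rw [ZMod.natCast_eq_natCast_iff] at h
    exact Nat.ModEq.eq_of_lt_of_lt h ha hb
  have hemb : Function.Injective emb := by
    intro x y h
    funext t
    exact Fin.ext (hcast _ _ ((x t).2.trans hdq) ((y t).2.trans hdq) (congrFun h t))
  refine ⟨(Finset.univ.filter fun x => nrm x = s).image emb, ?_, fun b hb hsum => ?_⟩
  · rwa [Finset.card_image_of_injective _ hemb]
  · choose x hx hxb using fun i => Finset.mem_image.1 (hb i)
    -- Since `κ * d < q`, coordinate sums do not wrap around, and the relation holds over the
    -- integers.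
    have hnat : ∀ t, ∑ i : Fin κ, (x i.castSucc t : ℕ) = κ * x (Fin.last κ) t := by
      intro t
      refine hcast _ _ ?_ ?_ ?_
      · refine lt_of_le_of_lt (Finset.sum_le_card_nsmul _ _ d fun i _ => (x _ t).2.le) ?_
        simpa using hq
      · exact lt_of_le_of_lt (Nat.mul_le_mul_left κ (x _ t).2.le) hq
      · have h1 := congrFun hsum t
        rw [Finset.sum_apply] at h1
        simp only [← hxb] at h1
        push_cast
        rw [Pi.smul_apply, nsmul_eq_mul] at h1
        exact h1
    have hlast : ∀ i : Fin κ, b i.castSucc = b (Fin.last κ) := by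
      intro i
      rw [← hxb, ← hxb]
      congr 1
      have h2 := eq_of_sum_eq_of_sum_sq_eq (s := (s : ℤ))
        (x := fun i t => ((x (Fin.castSucc i) t : ℕ) : ℤ))
        (y := fun t => ((x (Fin.last κ) t : ℕ) : ℤ)) (fun t => by exact_mod_cast hnat t)
        (fun i => by exact_mod_cast (Finset.mem_filter.1 (hx i.castSucc)).2)
        (by exact_mod_cast (Finset.mem_filter.1 (hx (Fin.last κ))).2) i
      funext t
      exact Fin.ext (by exact_mod_cast congrFun h2 t)
    have hall : ∀ i, b i = b (Fin.last κ) := fun i => Fin.lastCases rfl hlast i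
    intro i i'
    rw [hall i, hall i']

end Sphere

/-! ### Choice of parameters -/

section Parameters

theorem succ_pow_sq_le (n : ℕ) : (n + 1) ^ (n + 1) ^ 2 ≤ (n + 2) ^ (n * (n + 2)) := by
  have hn : (0 : ℝ) < (n : ℝ) + 1 := by positivity
  have h1 := one_add_mul_le_pow (a := 1 / ((n : ℝ) + 1))
    (by have : (0 : ℝ) < 1 / ((n : ℝ) + 1) := by positivity
        linarith) (n * (n + 2))
  have h2 : (n : ℝ) + 1 ≤ 1 + ((n * (n + 2) : ℕ) : ℝ) * (1 / ((n : ℝ) + 1)) := by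
    push_cast
    rw [← sub_le_iff_le_add', mul_one_div, le_div_iff₀ hn]
    nlinarith
  have h3 : 1 + 1 / ((n : ℝ) + 1) = ((n : ℝ) + 2) / ((n : ℝ) + 1) := by
    field_simp
    ring
  have h4 := h2.trans h1
  rw [h3, div_pow, le_div_iff₀ (by positivity)] at h4
  have h5 : ((n : ℝ) + 1) ^ (n + 1) ^ 2 ≤ ((n : ℝ) + 2) ^ (n * (n + 2)) := by
    refine le_trans (le_of_eq ?_) h4
    rw [← pow_succ']
    congr 1
    ring
  exact_mod_cast h5

/-- This is the monotonicity of `m ^ (m / (m - 1))`: the largest fibre size `κ` imposes the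
strongest condition on `|G|`. `succ_pow_sq_le` is the step from `n + 1` to `n + 2`. -/
theorem pow_mul_le_pow_mul {m κ : ℕ} (hm : 1 ≤ m) (h : m ≤ κ) :
    m ^ (m * (κ - 1)) ≤ κ ^ (κ * (m - 1)) := by
  induction κ, h using Nat.le_induction with
  | base => exact le_rfl
  | succ κ h ih =>
    obtain ⟨n, rfl⟩ := Nat.exists_eq_add_of_le' (hm.trans h)
    rcases Nat.eq_zero_or_pos n with rfl | hn
    · have : m = 1 := by lia
      subst this
      simp
    rw [Nat.add_sub_cancel] at ih ⊢
    rw [← Nat.pow_le_pow_iff_left hn.ne']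
    calc (m ^ (m * (n + 1))) ^ n = (m ^ (m * n)) ^ (n + 1) := by
          rw [← pow_mul, ← pow_mul]
          congr 1
          ring
      _ ≤ ((n + 1) ^ ((n + 1) * (m - 1))) ^ (n + 1) := Nat.pow_le_pow_left ih _
      _ = ((n + 1) ^ (n + 1) ^ 2) ^ (m - 1) := by
          rw [← pow_mul, ← pow_mul]
          congr 1
          ring
      _ ≤ ((n + 2) ^ (n * (n + 2))) ^ (m - 1) := Nat.pow_le_pow_left (succ_pow_sq_le n) _
      _ = _ := by
          rw [← pow_mul, ← pow_mul]
          congr 1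
          ring

/-- Unmixable families whose size is, up to a lower order factor, as large as possible. -/
theorem exists_large_isUnmixable {κ D : ℕ} (hκ : 1 ≤ κ) (hD : 1 ≤ D) :
    ∃ A : ℕ, ∀ s : ℕ, 1 ≤ s → ∃ (r : ℕ)
      (P : Fin r → Fin ((κ + 1) * (D * max 1 (κ - 1) * s)) → Fin (κ + 1)), IsUnmixable P ∧
      (κ + 1) ^ ((κ + 1) * (D * max 1 (κ - 1) * s)) ≤ A * s ^ (κ + 1) * (κ ^ (2 * κ)) ^ s *
        κ ^ (κ * (D * max 1 (κ - 1) * s)) * r := by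
  set e := max 1 (κ - 1) with he
  set C := 2 * (κ + 1) ^ (κ + 1) with hC
  have he1 : 1 ≤ e := le_max_left _ _
  have hCκ : κ ≤ C := by
    have : κ + 1 ≤ (κ + 1) ^ (κ + 1) := Nat.le_self_pow (by lia) _
    lia
  refine ⟨(κ + 1) ^ (κ + 1) * (D * e) ^ (κ + 1) * D * 2 * (2 * C) ^ (D * κ), fun s hs => ?_⟩
  -- For `κ ≥ 2`, `d ^ D = κ ^ (κ * M / (κ - 1))` is the order of `|G| = q ^ D` required by hashing;
  -- the factor `e` makes the exponent integral. For `κ = 1` there is no condition, and `e = 1`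
  -- keeps `M` positive.
  set M := D * e * s with hM
  set d := κ ^ (κ * s) with hd
  have hd1 : 1 ≤ d := Nat.one_le_pow _ _ hκ
  obtain ⟨q, hqp, hq1, hq2⟩ := Nat.exists_prime_lt_and_le_two_mul (C * d)
    (Nat.mul_pos (lt_of_lt_of_le hκ hCκ) hd1).ne'
  have : NeZero q := ⟨hqp.ne_zero⟩
  obtain ⟨B, hBcard, hB⟩ := exists_average_free (κ := κ) (q := q) hD hd1 hκ
    (lt_of_le_of_lt (Nat.mul_le_mul_right d hCκ) hq1)
  have hcard : Fintype.card (Fin D → ZMod q) = q ^ D := by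
    rw [Fintype.card_fun, ZMod.card, Fintype.card_fin]
  have hG : ∀ m, 1 ≤ m → m < κ + 1 →
      C ^ (m - 1) * m ^ (m * M) ≤ Fintype.card (Fin D → ZMod q) ^ (m - 1) := by
    intro m hm1 hm2
    rcases Nat.eq_or_lt_of_le hm1 with rfl | hm3
    · simp
    have heκ : e = κ - 1 := by lia
    rw [hcard]
    calc C ^ (m - 1) * m ^ (m * M) = C ^ (m - 1) * (m ^ (m * (κ - 1))) ^ (D * s) := by
          rw [hM, heκ, ← pow_mul]
          congr 2
          ring
      _ ≤ C ^ (m - 1) * (κ ^ (κ * (m - 1))) ^ (D * s) :=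
          Nat.mul_le_mul_left _ (Nat.pow_le_pow_left (pow_mul_le_pow_mul hm1 (by lia)) _)
      _ = (C * d ^ D) ^ (m - 1) := by
          have h1 : (κ ^ (κ * (m - 1))) ^ (D * s) = (d ^ D) ^ (m - 1) := by
            rw [hd, ← pow_mul, ← pow_mul, ← pow_mul]
            congr 1
            ring
          rw [h1, ← mul_pow]
      _ ≤ ((C * d) ^ D) ^ (m - 1) := by
          refine Nat.pow_le_pow_left ?_ _
          rw [mul_pow]
          exact Nat.mul_le_mul_right _ (Nat.le_self_pow (by lia) C)
      _ ≤ (q ^ D) ^ (m - 1) := Nat.pow_le_pow_left (Nat.pow_le_pow_left hq1.le _) _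
  obtain ⟨r, P, hP, hr⟩ := exists_isUnmixable (M := M) hκ B hB hG
  refine ⟨r, P, hP, ?_⟩
  rw [hcard] at hr
  have hM1 : 1 ≤ M := Nat.mul_pos (Nat.mul_pos hD he1) hs
  have hbal := pow_le_card_balanced (κ + 1) hM1
  set b := (balanced (κ + 1) M (Fin ((κ + 1) * M))).card with hb
  have hdD : d ^ (D * κ) = d ^ D * κ ^ (κ * M) := by
    rcases Nat.eq_or_lt_of_le hκ with h1 | h1
    · subst h1; simp [hd]
    · have heκ : e = κ - 1 := by lia
      obtain ⟨n, rfl⟩ : ∃ n, κ = n + 1 := ⟨κ - 1, by lia⟩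
      rw [Nat.add_sub_cancel] at heκ
      rw [hM, heκ, hd, ← pow_mul, ← pow_mul, ← pow_add]
      congr 1
      ring
  refine Nat.le_of_mul_le_mul_left ?_ (pow_pos hd1 D)
  calc d ^ D * (κ + 1) ^ ((κ + 1) * M)
      ≤ (D * d ^ 2 * B.card) * ((κ + 1) ^ (κ + 1) * M ^ (κ + 1) * b) :=
        Nat.mul_le_mul hBcard hbal
    _ = D * d ^ 2 * ((κ + 1) ^ (κ + 1) * M ^ (κ + 1)) * (b * B.card) := by ring
    _ ≤ D * d ^ 2 * ((κ + 1) ^ (κ + 1) * M ^ (κ + 1)) * (2 * (q ^ D) ^ κ * r) :=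
        Nat.mul_le_mul_left _ hr
    _ ≤ D * d ^ 2 * ((κ + 1) ^ (κ + 1) * M ^ (κ + 1)) *
          (2 * (((2 * C) * d) ^ D) ^ κ * r) := by
        gcongr
        rw [mul_assoc]
        exact hq2
    _ = D * d ^ 2 * ((κ + 1) ^ (κ + 1) * M ^ (κ + 1)) *
          (2 * ((2 * C) ^ (D * κ) * d ^ (D * κ)) * r) := by
        rw [← pow_mul (2 * C * d), mul_pow (2 * C) d]
    _ = _ := by
        have h2 : d ^ 2 = (κ ^ (2 * κ)) ^ s := by
          rw [hd, ← pow_mul, ← pow_mul]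
          congr 1
          ring
        rw [hdD, h2, hM, mul_pow (D * e) s]
        ring

end Parameters

/-! ### The lower bound on the asymptotic subrank -/

section Conclusion

theorem le_of_pow_le_mul_pow {x y A : ℝ} (hx : 0 < x) (p : ℕ)
    (h : ∀ s : ℕ, 1 ≤ s → y ^ s ≤ A * (s : ℝ) ^ p * x ^ s) : y ≤ x := by
  by_contra! hxy
  have h1 : 1 < y / x := (one_lt_div hx).2 hxy
  have h2 := (tendsto_pow_const_div_const_pow_of_one_lt p h1).const_mul A
  rw [mul_zero] at h2
  obtain ⟨s, hs, hs1⟩ := ((h2.eventually (gt_mem_nhds one_pos)).and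
    (Filter.eventually_ge_atTop 1)).exists
  have h3 := h s hs1
  have h4 : 0 < (y / x) ^ s := by positivity
  rw [mul_div_assoc', div_lt_one h4, div_pow, lt_div_iff₀ (by positivity)] at hs
  linarith

variable {K : Type*} [Field K] {k : ℕ} {ι : Fin k → Type*} [∀ i, Fintype (ι i)]

theorem le_of_crossing (hk : 2 ≤ k) {T : ⨂[K] i, (ι i → K)}
    (h : ∀ A : Finset (Fin k), A.Nonempty → A ≠ Finset.univ →
      ∃ i ∈ A, ∃ j ∉ A, ¬Exch (contract K (toArray T)) {i} {j})
    {q : ℝ} (hq : 1 ≤ q)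
    (hQ : ∀ N : ℕ, 0 < N → (subrank (kroneckerPow T N) : ℝ) ≤ q ^ N) :
    (k : ℝ) / ((k : ℝ) - 1) ^ (((k : ℝ) - 1) / (k : ℝ)) ≤ q := by
  obtain ⟨m, hm⟩ := exists_le_subrank_of_isUnmixable hk h
  obtain ⟨κ, rfl⟩ : ∃ κ, k = κ + 1 := ⟨k - 1, by lia⟩
  have hκ : 1 ≤ κ := by lia
  have hκ' : (0 : ℝ) < κ := by exact_mod_cast hκ
  have hq0 : 0 < q := one_pos.trans_le hq
  set e := max 1 (κ - 1) with he
  have he1 : 1 ≤ e := le_max_left _ _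
  set X : ℝ := κ ^ κ * q ^ (κ + 1) with hX
  set Y : ℝ := ((κ : ℝ) + 1) ^ (κ + 1) with hY
  have hX0 : 0 < X := by positivity
  have hY0 : 0 < Y := by positivity
  -- Two limits: for fixed `D`, letting `s` grow removes `A`, the polynomial factor and `q ^ m`.
  -- Behrend's loss `κ ^ (2 * κ)` per unit of `s` does not depend on `D` and disappears as `D`
  -- grows. The factor `D ^ 0` only fits the shape of `le_of_pow_le_mul_pow`.
  have hD : ∀ D : ℕ, 1 ≤ D → (Y ^ e) ^ D ≤ (κ : ℝ) ^ (2 * κ) * ((D : ℝ) ^ 0) * (X ^ e) ^ D := by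
    intro D hD
    obtain ⟨A, hA⟩ := exists_large_isUnmixable hκ hD
    rw [pow_zero, mul_one]
    refine le_of_pow_le_mul_pow (A := A * q ^ m) (by positivity) (κ + 1) fun s hs => ?_
    obtain ⟨r, P, hP, hr⟩ := hA s hs
    have h1 := hm _ r P hP
    have h2 : (r : ℝ) ≤ q ^ ((κ + 1) * (D * e * s) + m) :=
      le_trans (by exact_mod_cast h1) (hQ _ (by positivity))
    have h3 : ((κ : ℝ) + 1) ^ ((κ + 1) * (D * e * s)) ≤ A * (s : ℝ) ^ (κ + 1) *
        ((κ : ℝ) ^ (2 * κ)) ^ s * (κ : ℝ) ^ (κ * (D * e * s)) * r := by exact_mod_cast hr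
    calc ((Y ^ e) ^ D) ^ s = ((κ : ℝ) + 1) ^ ((κ + 1) * (D * e * s)) := by
          rw [hY, ← pow_mul, ← pow_mul, ← pow_mul]
          congr 1
          ring
      _ ≤ _ := h3
      _ ≤ A * (s : ℝ) ^ (κ + 1) * ((κ : ℝ) ^ (2 * κ)) ^ s * (κ : ℝ) ^ (κ * (D * e * s)) *
          q ^ ((κ + 1) * (D * e * s) + m) := by gcongr
      _ = _ := by
          have h4 : ((X ^ e) ^ D) ^ s =
              (κ : ℝ) ^ (κ * (D * e * s)) * q ^ ((κ + 1) * (D * e * s)) := by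
            rw [hX, ← pow_mul, ← pow_mul, pow_mul (κ : ℝ), pow_mul q, ← mul_pow]
            congr 1
            ring
          rw [mul_pow, h4, pow_add]
          ring
  have hYX : Y ≤ X := by
    have h1 := le_of_pow_le_mul_pow (by positivity) 0 hD
    exact le_of_pow_le_pow_left₀ (by lia) hX0.le h1
  push_cast
  rw [add_sub_cancel_right]
  have hc0 : (0 : ℝ) < (κ : ℝ) ^ ((κ : ℝ) / ((κ : ℝ) + 1)) := Real.rpow_pos_of_pos hκ' _
  refine le_of_pow_le_pow_left₀ (n := κ + 1) (by lia) hq0.le ?_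
  rw [div_pow, ← Real.rpow_natCast ((κ : ℝ) ^ ((κ : ℝ) / ((κ : ℝ) + 1))), ← Real.rpow_mul hκ'.le]
  push_cast
  rw [div_mul_cancel₀ _ (by positivity), Real.rpow_natCast, div_le_iff₀ (by positivity), mul_comm]
  exact hYX

end Conclusion

end KTensor

theorem mainTheorem9 {K : Type*} [Field K] {k : ℕ} (hk : 2 ≤ k) (n : Fin k → ℕ)
    (T : ⨂[K] i, (Fin (n i) → K)) (hT : T ≠ 0) :
    Filter.Tendsto (fun N : ℕ => (KTensor.subrank (KTensor.kroneckerPow T N) : ℝ) ^ (1 / (N : ℝ)))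
        Filter.atTop (𝓝 (KTensor.asymptoticSubrank T)) ∧
      (KTensor.asymptoticSubrank T = 1 ∨
        (k : ℝ) / ((k : ℝ) - 1) ^ (((k : ℝ) - 1) / (k : ℝ)) ≤ KTensor.asymptoticSubrank T) := by
  obtain ⟨q, hq1, hq, hQ⟩ := KTensor.exists_tendsto_subrank hk hT
  have hlim : KTensor.asymptoticSubrank T = q := hq.limUnder_eq
  rw [hlim]
  refine ⟨hq, ?_⟩
  by_cases h : ∀ A : Finset (Fin k), A.Nonempty → A ≠ Finset.univ →
      ∃ i ∈ A, ∃ j ∉ A, ¬KTensor.Exch (KTensor.contract K (KTensor.toArray T)) {i} {j}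
  · exact Or.inr (KTensor.le_of_crossing hk h hq1 hQ)
  · push Not at h
    obtain ⟨A, hA, hA', h⟩ := h
    left
    have hexch : KTensor.Exch (KTensor.contract K (KTensor.toArray T)) A Aᶜ :=
      KTensor.exch_of_forall_singleton disjoint_compl_right
        fun i hi j hj => h i hi j (Finset.mem_compl.1 hj)
    refine tendsto_nhds_unique hq ?_
    simp only [KTensor.subrank_eq_one_of_exch hk hT hexch hA hA', Nat.cast_one, Real.one_rpow]
    exact tendsto_const_nhds
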